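/- Let $1<p<\infty$, $\alpha\in(1/p,1]$ and $q\in[1,\infty]$. For $n\in\mathbb N$ and a family $\tilde f=(\tilde f_u)_{u\subseteq\{1,\dots,n\}}$ with $\tilde f_u\in L_p([0,1]^u)$ (where $L_p([0,1]^\emptyset):=\mathbb R$), put $$\Phi(\tilde f)(x)=\sum_{u\subseteq\{1,\dots,n\}}\Gamma(\alpha)^{-|u|}\int_{[0,1]^u}\tilde f_u(t)\prod_{j\in u}(x_j-t_j)_+^{\alpha-1}\,dt,\qquad x\in[0,1]^n ,$$ where $(x_j-t_j)_+^{\alpha-1}$ is $(x_j-t_j)^{\alpha-1}$ if $x_j>t_j$ and $0$ otherwise. Let $\mathcal H_{\alpha,n,p}$ be the space of all functions $f:[0,1]^n\to\mathbb R$ of the form $f=\Phi(\tilde f)$; the family $\tilde f$ is uniquely determined by $f$, and $\mathcal H_{\alpha,n,p,q}$ denotes this space with the norm $$\|f\|_{\alpha,n,p,q}=\Big(\sum_{u}\Gamma(\alpha)^{-q|u|}\,\|\tilde f_u\|_{L_p}^q\Big)^{1/q}$$ (a maximum over $u$ of $\Gamma(\alpha)^{-|u|}\|\tilde f_u\|_{L_p}$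 if $q=\infty$). Different $q$ give equivalent norms. Write $\mathcal H_{\alpha,p}:=\mathcal H_{\alpha,1,p}$. For Banach spaces $X,Y$ and $1/p+1/p'=1$, the $p$-nuclear norm of $h$ in the algebraic tensor product $X\otimes Y$ is $$\delta_p(h)=\inf\Big\{\Big(\sum_{i=1}^m\|f_i\|_X^p\Big)^{1/p}\sup_{\psi\in Y',\,\|\psi\|\le1}\Big(\sum_{i=1}^m|\psi(g_i)|^{p'}\Big)^{1/p'}\;:\;h=\sum_{i=1}^m f_i\otimes g_i\Big\},$$ and $X\otimes_{\delta_p}Y$ is the completion of $X\otimes Y$ with respect to $\delta_p$. **Theorem.** Let $1<p<\infty$, $\alpha\in(1/p,1]$ and let $s\ge2$ be an integer. Then $$\mathcal H_{\alpha,s-1,p}\otimes_{\delta_p}\mathcal H_{\alpha,p}=\mathcal H_{\alpha,s,p}$$ in the sense of equivalent norms: for all $q_1,q_2,q\in[1,\infty]$ there is a linear homeomorphism from $\mathcal H_{\alpha,s-1,p,q_1}\otimes_{\delta_p}\mathcal H_{\alpha,1,p,q_2}$ onto $\mathcal H_{\alpha,s,p,q}$ that maps each elementary tensor $f\otimes g$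 to the function $x\mapsto f(x_1,\dots,x_{s-1})\,g(x_s)$. -/

import Mathlib

open MeasureTheory Set
open scoped ENNReal TensorProduct unitInterval

namespace FracSmooth

/-- The kernel `(x - t)₊ ^ (α - 1)`. -/
noncomputable def kernel (α : ℝ) (x t : I) : ℝ :=
  if t < x then ((x : ℝ) - t) ^ (α - 1) else 0

theorem kernel_nonneg (α : ℝ) (x t : I) : 0 ≤ kernel α x t := by
  unfold kernel
  split_ifs with h
  · have : (t : ℝ) < x := h
    exact Real.rpow_nonneg (by linarith) _
  · exact le_rfl

theorem measurable_kernel (α : ℝ) : Measurable (fun z : I × I => kernel α z.1 z.2) := by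
  unfold kernel
  refine Measurable.ite (measurableSet_lt measurable_snd measurable_fst) ?_ measurable_const
  fun_prop

theorem measurable_kernel_right (α : ℝ) (x : I) : Measurable (kernel α x) :=
  (measurable_kernel α).comp measurable_prodMk_left

theorem integrable_kernel {a : ℝ} (ha : 0 < a) (x : I) : Integrable (kernel a x) := by
  have h1 : IntervalIntegrable (fun t : ℝ => ((x : ℝ) - t) ^ (a - 1)) volume 0 x := by
    have h := (intervalIntegral.intervalIntegrable_rpow' (a := 0) (b := (x : ℝ))
      (r := a - 1) (by linarith)).comp_sub_left (x : ℝ)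
    simpa using h.symm
  have h2 : Integrable ((Ioo (0 : ℝ) x).indicator fun t : ℝ => ((x : ℝ) - t) ^ (a - 1)) := by
    rw [integrable_indicator_iff measurableSet_Ioo]
    exact ((intervalIntegrable_iff_integrableOn_Ioc_of_le x.2.1).1 h1).mono_set Ioo_subset_Ioc_self
  have h3 := (unitInterval.measurePreserving_coe.integrable_comp_emb
    unitInterval.measurableEmbedding_coe).2 (h2.mono_measure Measure.restrict_le_self)
  refine h3.congr ?_
  have h0 : ∀ᵐ t : I, t ≠ 0 := by
    simp [ae_iff]
  filter_upwards [h0] with t ht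
  have ht' : (0 : ℝ) < t := unitInterval.pos_iff_ne_zero.2 ht
  simp only [Function.comp, kernel, indicator, mem_Ioo, ht', true_and]
  rfl

theorem kernel_rpow {α r : ℝ} (hr : 0 < r) (x t : I) :
    kernel α x t ^ r = kernel ((α - 1) * r + 1) x t := by
  unfold kernel
  split_ifs with h
  · have : (t : ℝ) < x := h
    rw [← Real.rpow_mul (by linarith)]
    ring_nf
  · exact Real.zero_rpow hr.ne'

/-- The product kernel belongs to `L_r` if `r (1 - α) < 1`. -/
theorem memLp_prod_kernel {ι : Type*} [Fintype ι] {α r : ℝ} (hr : 0 < r)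
    (hα : r * (1 - α) < 1) (x : ι → I) :
    MemLp (fun t : ι → I => ∏ j, kernel α (x j) (t j)) (ENNReal.ofReal r) volume := by
  have hm : Measurable (fun t : ι → I => ∏ j, kernel α (x j) (t j)) :=
    Finset.measurable_prod _ fun j _ =>
      (measurable_kernel_right α (x j)).comp (measurable_pi_apply j)
  refine (integrable_norm_rpow_iff hm.aestronglyMeasurable (by simpa using hr) (by simp)).1 ?_
  have h := Integrable.fintype_prod (μ := fun _ : ι => (volume : Measure I))
    (f := fun j => kernel ((α - 1) * r + 1) (x j))
    (fun j => integrable_kernel (by nlinarith) (x j))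
  refine h.congr (Filter.Eventually.of_forall fun t => ?_)
  simp only [ENNReal.toReal_ofReal hr.le, Real.norm_eq_abs]
  rw [abs_of_nonneg (Finset.prod_nonneg fun j _ => kernel_nonneg _ _ _),
    ← Real.finsetProd_rpow _ _ (fun j _ => kernel_nonneg _ _ _)]
  exact Finset.prod_congr rfl fun j _ => (kernel_rpow hr _ _).symm

theorem integrable_mul_prod_kernel {ι : Type*} [Fintype ι] {α p : ℝ} (hp : 1 < p)
    (hα : 1 / p < α) {f : (ι → I) → ℝ} (hf : MemLp f (ENNReal.ofReal p) volume) (x : ι → I) :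
    Integrable (fun t : ι → I => f t * ∏ j, kernel α (x j) (t j)) := by
  have hpq := Real.HolderConjugate.conjExponent hp
  have hq := hpq.symm.pos
  have h1 : p.conjExponent * (1 - α) < 1 := by
    have h2 : p.conjExponent⁻¹ = 1 - p⁻¹ := by have := hpq.inv_add_inv_eq_one; linarith
    have h3 : 1 - α < p.conjExponent⁻¹ := by rw [h2]; rw [one_div] at hα; linarith
    calc p.conjExponent * (1 - α) < p.conjExponent * p.conjExponent⁻¹ := by gcongr
      _ = 1 := mul_inv_cancel₀ hq.ne'
  have : ENNReal.HolderConjugate (ENNReal.ofReal p) (ENNReal.ofReal p.conjExponent) := 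
    Real.HolderConjugate.ennrealOfReal hpq
  exact MemLp.integrable_mul hf (memLp_prod_kernel hq h1 x)

theorem integral_beta {α a : ℝ} (h0 : 0 < α) (h1 : α < 1) (ha : 0 < a) :
    ∫ x in (0 : ℝ)..a, x ^ (α - 1) * (a - x) ^ (1 - α - 1) =
      Real.Gamma α * Real.Gamma (1 - α) := by
  have h := Complex.betaIntegral_scaled (α : ℂ) (1 - α : ℂ) ha
  have hG := Complex.Gamma_mul_Gamma_eq_betaIntegral (s := (α : ℂ)) (t := (1 - α : ℂ))
    (by simpa using h0) (by simpa using h1)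
  have e1 : (α : ℂ) + (1 - α) = 1 := by ring
  rw [e1, Complex.Gamma_one, one_mul] at hG
  rw [e1, sub_self, Complex.cpow_zero, one_mul, ← hG] at h
  apply Complex.ofReal_injective
  rw [← intervalIntegral.integral_ofReal]
  push_cast
  rw [← Complex.Gamma_ofReal, ← Complex.Gamma_ofReal]
  push_cast
  rw [← h]
  refine intervalIntegral.integral_congr_ae ?_
  refine Filter.Eventually.of_forall fun x hx => ?_
  rw [uIoc_of_le ha.le] at hx
  rw [Complex.ofReal_cpow hx.1.le, Complex.ofReal_cpow (by linarith [hx.2])]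
  push_cast
  rfl

/-- `∫ (y - x)₊ ^ (-α) (x - t)₊ ^ (α - 1) dx = Γ(α) Γ(1 - α)` if `t < y`, and `0` otherwise. -/
theorem kernel_conv {α : ℝ} (h0 : 0 < α) (h1 : α < 1) (y t : I) :
    Integrable (fun x : I => kernel α x t * kernel (1 - α) y x) ∧
    ∫ x : I, kernel α x t * kernel (1 - α) y x =
      if t < y then Real.Gamma α * Real.Gamma (1 - α) else 0 := by
  split_ifs with h
  · have hty : (t : ℝ) < y := h
    set F : ℝ → ℝ := (Ioo (t : ℝ) y).indicator
      fun x => (x - t) ^ (α - 1) * (y - x) ^ (1 - α - 1) with hF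
    have e : (fun x : I => kernel α x t * kernel (1 - α) y x) = fun x : I => F x := by
      funext x
      have c1 : t < x ↔ (t : ℝ) < x := Iff.rfl
      have c2 : x < y ↔ (x : ℝ) < y := Iff.rfl
      simp only [kernel, hF, indicator, mem_Ioo, c1, c2]
      split_ifs <;> simp_all
    have hI : ∫ x : I, F x = Real.Gamma α * Real.Gamma (1 - α) := by
      rw [unitInterval.measurePreserving_coe.integral_comp unitInterval.measurableEmbedding_coe,
        hF, setIntegral_indicator measurableSet_Ioo, inter_eq_right.2
          (Ioo_subset_Icc_self.trans (Icc_subset_Icc t.2.1 y.2.2)),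
        ← integral_Ioc_eq_integral_Ioo, ← intervalIntegral.integral_of_le hty.le]
      have h2 := integral_beta h0 h1 (a := (y : ℝ) - t) (by linarith)
      have h3 := intervalIntegral.integral_comp_sub_right (a := (t : ℝ)) (b := y)
        (fun x => x ^ (α - 1) * ((y : ℝ) - t - x) ^ (1 - α - 1)) (t : ℝ)
      rw [sub_self, h2] at h3
      rw [← h3]
      congr 1
      funext x
      ring_nf
    rw [e]
    refine ⟨?_, hI⟩
    by_contra hc
    rw [integral_undef hc] at hI
    have := mul_pos (Real.Gamma_pos_of_pos h0) (Real.Gamma_pos_of_pos (s := 1 - α) (by linarith))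
    linarith
  · have e : (fun x : I => kernel α x t * kernel (1 - α) y x) = fun _ => 0 := by
      funext x
      unfold kernel
      split_ifs with h2 h3
      · exact absurd (h2.trans h3) h
      all_goals simp
    rw [e]
    exact ⟨integrable_zero _ _ _, by simp⟩

theorem ae_zero_of_boxes {ι : Type*} [Fintype ι] {g : (ι → I) → ℝ} (hg : Integrable g)
    (h : ∀ y : ι → I, ∫ t in Set.pi univ (fun j => Iio (y j)), g t = 0) : g =ᵐ[volume] 0 := by
  have hIic : ∀ y : ι → I, ∫ t in Set.pi univ (fun j => Iic (y j)), g t = 0 := fun y => by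
    rw [← h y]
    have e := Measure.univ_pi_Iio_ae_eq_Iic (μ := fun _ : ι => (volume : Measure I)) (f := y)
    rw [← Set.pi_univ_Iic y] at e
    exact setIntegral_congr_set e.symm
  have hspan : IsCountablySpanning (range (Iic : I → Set I)) :=
    ⟨fun _ => Iic 1, fun _ => ⟨1, rfl⟩, by
      rw [iUnion_const]; exact eq_univ_of_forall fun x => unitInterval.le_one x⟩
  have hgen : (MeasurableSpace.pi : MeasurableSpace (ι → I)) =
      MeasurableSpace.generateFrom (Set.pi univ '' Set.pi univ fun _ => range (Iic : I → Set I)) :=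
    (generateFrom_eq_pi (fun _ => (borel_eq_generateFrom_Iic I).symm.trans
      (BorelSpace.measurable_eq (α := I)).symm) fun _ => hspan).symm
  have huniv : ∫ t, g t = 0 := by
    have := hIic fun _ => 1
    rwa [show (Set.pi univ fun _ : ι => Iic (1 : I)) = univ from
      eq_univ_of_forall fun x j _ => unitInterval.le_one (x j), setIntegral_univ] at this
  have key : ∀ s : Set (ι → I), MeasurableSet s → ∫ t in s, g t = 0 := by
    intro s hs
    induction s, hs using MeasurableSpace.induction_on_inter hgen
      (IsPiSystem.pi fun _ => by
        rintro _ ⟨a, rfl⟩ _ ⟨b, rfl⟩ _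
        exact ⟨a ⊓ b, Iic_inter_Iic.symm⟩) with
    | empty => simp
    | basic s hs =>
      obtain ⟨C, hC, rfl⟩ := hs
      choose y hy using fun j => hC j (mem_univ j)
      rw [← hIic y]
      simp_rw [hy]
    | compl s hs ih =>
      have := integral_add_compl hs hg
      rw [ih, huniv, zero_add] at this
      exact this
    | iUnion f hd hm ih =>
      rw [integral_iUnion hm hd hg.integrableOn]
      simp [ih]
  exact hg.ae_eq_zero_of_forall_setIntegral_eq_zero fun s hs _ => key s hs

/-- Uniqueness of the density: the mixed fractional integral is injective. -/
theorem ae_zero_of_integral_kernel {ι : Type*} [Fintype ι] {α : ℝ} (h0 : 0 < α) (h1 : α ≤ 1)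
    {g : (ι → I) → ℝ} (hg : Integrable g)
    (h : ∀ x : ι → I, ∫ t, g t * ∏ j, kernel α (x j) (t j) = 0) : g =ᵐ[volume] 0 := by
  classical
  refine ae_zero_of_boxes hg fun y => ?_
  have hbox : MeasurableSet (Set.pi univ fun j => Iio (y j)) :=
    MeasurableSet.univ_pi fun j => measurableSet_Iio
  have hind : ∀ (c : ℝ) (t : ι → I), g t * ∏ j, (if t j < y j then c else 0) =
      c ^ Fintype.card ι * (Set.pi univ fun j => Iio (y j)).indicator g t := by
    intro c t
    by_cases ht : ∀ j, t j < y j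
    · rw [indicator_of_mem (by simpa using ht), Finset.prod_congr rfl fun j _ => if_pos (ht j)]
      simp [Finset.card_univ, mul_comm]
    · rw [indicator_of_notMem (by simpa using ht)]
      push Not at ht
      obtain ⟨j, hj⟩ := ht
      rw [Finset.prod_eq_zero (Finset.mem_univ j) (if_neg (not_lt.2 hj))]
      simp
  rcases h1.lt_or_eq with h1 | rfl
  · set c := Real.Gamma α * Real.Gamma (1 - α) with hc
    have hc0 : 0 < c := mul_pos (Real.Gamma_pos_of_pos h0) (Real.Gamma_pos_of_pos (by linarith))
    let H : (ι → I) × (ι → I) → ℝ := fun z =>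
      g z.1 * ∏ j, (kernel α (z.2 j) (z.1 j) * kernel (1 - α) (y j) (z.2 j))
    have hprod : ∀ t : ι → I, Integrable (fun x : ι → I =>
        ∏ j, (kernel α (x j) (t j) * kernel (1 - α) (y j) (x j))) := fun t =>
      Integrable.fintype_prod (μ := fun _ : ι => (volume : Measure I))
        (f := fun j x => kernel α x (t j) * kernel (1 - α) (y j) x)
        fun j => (kernel_conv h0 h1 (y j) (t j)).1
    have hval : ∀ t : ι → I,
        ∫ x : ι → I, ∏ j, (kernel α (x j) (t j) * kernel (1 - α) (y j) (x j)) =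
          ∏ j, (if t j < y j then c else 0) := fun t => by
      rw [integral_fintype_prod_volume_eq_prod
        (fun j x => kernel α x (t j) * kernel (1 - α) (y j) x)]
      exact Finset.prod_congr rfl fun j _ => (kernel_conv h0 h1 (y j) (t j)).2
    have hmeas : AEStronglyMeasurable H (volume.prod volume) := by
      refine hg.aestronglyMeasurable.comp_fst.mul (Measurable.aestronglyMeasurable ?_)
      refine Finset.measurable_prod _ fun j _ => Measurable.mul ?_ ?_
      · have hj : Measurable fun z : (ι → I) × (ι → I) => (z.2 j, z.1 j) := by fun_prop
        exact (measurable_kernel α).comp hj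
      · exact (measurable_kernel_right _ _).comp ((measurable_pi_apply j).comp measurable_snd)
    have hHint : Integrable H (volume.prod volume) := by
      rw [integrable_prod_iff hmeas]
      refine ⟨Filter.Eventually.of_forall fun t => (hprod t).const_mul (g t), ?_⟩
      have hI := ((hg.indicator hbox).norm.const_mul (c ^ Fintype.card ι))
      refine hI.congr (Filter.Eventually.of_forall fun t => ?_)
      have e : ∀ x : ι → I, ‖H (t, x)‖ =
          ‖g t‖ * ∏ j, (kernel α (x j) (t j) * kernel (1 - α) (y j) (x j)) := fun x => by
        simp only [H, norm_mul]
        congr 1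
        rw [Real.norm_eq_abs, abs_of_nonneg (Finset.prod_nonneg fun j _ =>
          mul_nonneg (kernel_nonneg _ _ _) (kernel_nonneg _ _ _))]
      simp only [e]
      rw [integral_const_mul, hval]
      have := congrArg norm (hind c t)
      rw [norm_mul, norm_mul, Real.norm_of_nonneg (Finset.prod_nonneg fun j _ => by
        split_ifs <;> positivity), Real.norm_of_nonneg (pow_nonneg hc0.le _)] at this
      exact this.symm
    have hswap := integral_integral_swap (f := fun t x => H (t, x)) hHint
    have hR : ∫ x, ∫ t, H (t, x) = 0 := by
      refine (integral_congr_ae (Filter.Eventually.of_forall fun x => ?_)).trans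
        (integral_zero _ _)
      have e : ∀ t, H (t, x) = (∏ j, kernel (1 - α) (y j) (x j)) *
          (g t * ∏ j, kernel α (x j) (t j)) := fun t => by
        simp only [H, Finset.prod_mul_distrib]
        ring
      simp only [e]
      rw [integral_const_mul, h x, mul_zero]
    have hL : ∫ t, ∫ x, H (t, x) =
        c ^ Fintype.card ι * ∫ t in Set.pi univ (fun j => Iio (y j)), g t := by
      rw [← integral_indicator hbox, ← integral_const_mul]
      refine integral_congr_ae (Filter.Eventually.of_forall fun t => ?_)
      simp only [H]
      rw [integral_const_mul, hval, hind]
    rw [hR, hL] at hswap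
    exact (mul_eq_zero.1 hswap).resolve_left (pow_pos hc0 _).ne'
  · have e : ∀ t, g t * ∏ j, kernel 1 (y j) (t j) =
        (Set.pi univ fun j => Iio (y j)).indicator g t := fun t => by
      have := hind 1 t
      rw [one_pow, one_mul] at this
      rw [← this]
      simp [kernel]
    have := h y
    simp only [e] at this
    rwa [integral_indicator hbox] at this

section Space

instance fact_one_le_ofReal (p : ℝ) [hp : Fact (1 < p)] : Fact (1 ≤ ENNReal.ofReal p) :=
  ⟨by simpa using ENNReal.ofReal_le_ofReal hp.out.le⟩

/-- `L_p([0,1]^u)`. For `u = ∅` the cube is a one-point space of mass one, so that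
`L_p([0,1]^∅)` is `ℝ` with the absolute value. -/
abbrev LpCube {s : ℕ} (p : ℝ) (u : Finset (Fin s)) : Type :=
  Lp ℝ (ENNReal.ofReal p) (volume : Measure (u → I))

/-- Families `(f̃_u)_{u ⊆ S}` with `f̃_u ∈ L_p([0,1]^u)`. -/
abbrev Densities (s : ℕ) (p : ℝ) : Type := (u : Finset (Fin s)) → LpCube p u

theorem alpha_pos (α p : ℝ) [hp : Fact (1 < p)] [hα : Fact (1 / p < α)] : 0 < α :=
  lt_trans (one_div_pos.2 (zero_lt_one.trans hp.out)) hα.out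

variable (s : ℕ) (α p : ℝ) [hp : Fact (1 < p)] [hα : Fact (1 / p < α)] [hα1 : Fact (α ≤ 1)]

/-- The map `Φ((f̃_u)_u)(x) = ∑_u Γ(α)^{-|u|} ∫_{[0,1]^u} f̃_u(t_u) ∏_{j ∈ u} (x_j - t_j)₊^{α-1} dt_u`
from families of densities to functions on the cube. -/
noncomputable def Phi : Densities s p →ₗ[ℝ] ((Fin s → I) → ℝ) where
  toFun F x := ∑ u : Finset (Fin s),
    (Real.Gamma α)⁻¹ ^ u.card * ∫ t : u → I, F u t * ∏ j : u, kernel α (x j) (t j)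
  map_add' F G := by
    funext x
    simp only [Pi.add_apply, ← Finset.sum_add_distrib, ← mul_add]
    refine Finset.sum_congr rfl fun u _ => ?_
    rw [← integral_add (μ := (volume : Measure (u → I)))
      (integrable_mul_prod_kernel hp.out hα.out (Lp.memLp (F u)) fun j : u => x j)
      (integrable_mul_prod_kernel hp.out hα.out (Lp.memLp (G u)) fun j : u => x j)]
    congr 1
    refine integral_congr_ae ?_
    filter_upwards [Lp.coeFn_add (F u) (G u)] with t ht
    rw [ht, Pi.add_apply, add_mul]
  map_smul' c F := by
    funext x
    simp only [Pi.smul_apply, smul_eq_mul, RingHom.id_apply, Finset.mul_sum]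
    refine Finset.sum_congr rfl fun u _ => ?_
    have e : c * ∫ t : u → I, F u t * ∏ j : u, kernel α (x j) (t j) =
        ∫ t : u → I, c * (F u t * ∏ j : u, kernel α (x j) (t j)) := (integral_const_mul c _).symm
    rw [mul_left_comm c, e]
    congr 1
    refine integral_congr_ae ?_
    filter_upwards [Lp.coeFn_smul c (F u)] with t ht
    rw [ht, Pi.smul_apply, smul_eq_mul, mul_assoc]

/-- A function in the range of `Φ` determines its densities. -/
theorem Phi_injective : Function.Injective (Phi s α p) := by
  classical
  rw [injective_iff_map_eq_zero]
  intro F hF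
  have hα0 : 0 < α := alpha_pos α p
  have hΓ := Real.Gamma_pos_of_pos hα0
  suffices ∀ n : ℕ, ∀ u : Finset (Fin s), u.card = n → F u = 0 from
    funext fun u => this _ u rfl
  intro n
  induction n using Nat.strong_induction_on with
  | _ n ih =>
    intro u hu
    have hint : Integrable (F u : (u → I) → ℝ) := (Lp.memLp (F u)).integrable Fact.out
    refine (Lp.eq_zero_iff_ae_eq_zero).2 (ae_zero_of_integral_kernel hα0 hα1.out hint fun x => ?_)
    let z : Fin s → I := fun j => if h : j ∈ u then x ⟨j, h⟩ else 0
    have h0 := congrFun hF z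
    simp only [Phi, LinearMap.coe_mk, AddHom.coe_mk, Pi.zero_apply] at h0
    rw [Finset.sum_eq_single u] at h0
    · have h1 := (mul_eq_zero.1 h0).resolve_left (pow_ne_zero _ (inv_ne_zero hΓ.ne'))
      rw [← h1]
      refine integral_congr_ae (Filter.Eventually.of_forall fun t => ?_)
      simp [z]
    · intro v _ hvu
      by_cases hsub : v ⊆ u
      · have hv : F v = 0 := ih _ (hu ▸ Finset.card_lt_card (hsub.ssubset_of_ne hvu)) v rfl
        rw [hv]
        have : ∫ t : v → I, (0 : LpCube p v) t * ∏ j : v, kernel α (z j) (t j) = 0 := by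
          refine (integral_congr_ae ?_).trans (integral_zero _ _)
          filter_upwards [Lp.coeFn_zero ℝ (ENNReal.ofReal p) (volume : Measure (v → I))] with t ht
          rw [ht, Pi.zero_apply, zero_mul]
        rw [this, mul_zero]
      · obtain ⟨j, hjv, hju⟩ := Finset.not_subset.1 hsub
        have : ∀ t : v → I, ∏ i : v, kernel α (z i) (t i) = 0 := fun t => by
          refine Finset.prod_eq_zero (Finset.mem_univ ⟨j, hjv⟩) ?_
          have hz : z j = 0 := dif_neg hju
          simp only [hz, kernel]
          exact if_neg (not_lt.2 (unitInterval.nonneg'))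
        simp only [this, mul_zero, integral_zero]
    · simp

/-- The space of fractional smoothness `H_{α,s,p,q}`: the functions on `[0,1]^s` of the form
`Φ((f̃_u)_u)`. The parameter `q` only enters the norm. -/
def FracSpace (_q : ℝ≥0∞) : Type := LinearMap.range (Phi s α p)

variable (q : ℝ≥0∞)

noncomputable instance : AddCommGroup (FracSpace s α p q) :=
  inferInstanceAs (AddCommGroup (LinearMap.range (Phi s α p)))

noncomputable instance : Module ℝ (FracSpace s α p q) :=
  inferInstanceAs (Module ℝ (LinearMap.range (Phi s α p)))

noncomputable instance : CoeFun (FracSpace s α p q) (fun _ => (Fin s → I) → ℝ) :=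
  ⟨fun f => Subtype.val (p := fun h => h ∈ LinearMap.range (Phi s α p)) f⟩

/-- The unique densities `(f̃_u)_u` with `f = Φ((f̃_u)_u)` of a function of fractional smoothness. -/
noncomputable def densities : FracSpace s α p q ≃ₗ[ℝ] Densities s p :=
  (LinearEquiv.ofInjective (Phi s α p) (Phi_injective s α p)).symm

/-- The weighted densities `(Γ(α)^{-|u|} f̃_u)_u`, as a member of the `ℓ_q`-sum of the spaces
`L_p([0,1]^u)`. -/
noncomputable def weighted :
    FracSpace s α p q →ₗ[ℝ] PiLp q (fun u : Finset (Fin s) => LpCube p u) where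
  toFun f := WithLp.toLp q fun u => (Real.Gamma α)⁻¹ ^ u.card • densities s α p q f u
  map_add' f g := by
    ext1 u
    exact (congrArg ((Real.Gamma α)⁻¹ ^ u.card • ·)
      (congrFun (map_add (densities s α p q) f g) u)).trans (smul_add _ _ _)
  map_smul' c f := by
    ext1 u
    exact (congrArg ((Real.Gamma α)⁻¹ ^ u.card • ·)
      (congrFun (map_smul (densities s α p q) c f) u)).trans (smul_comm _ c (densities s α p q f u))

theorem weighted_injective : Function.Injective (weighted s α p q) := by
  intro f g h
  refine (densities s α p q).injective (funext fun u => ?_)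
  have hΓ := Real.Gamma_pos_of_pos (alpha_pos α p)
  have := congrArg (fun w : PiLp q (fun u : Finset (Fin s) => LpCube p u) => w u) h
  exact smul_right_injective _ (pow_ne_zero u.card (inv_ne_zero hΓ.ne')) this

/-- The norm `‖f‖_{α,s,p,q} = (∑_u Γ(α)^{-q|u|} ‖f̃_u‖_{L_p}^q)^{1/q}` (a maximum for `q = ∞`). -/
noncomputable instance [Fact (1 ≤ q)] : NormedAddCommGroup (FracSpace s α p q) :=
  NormedAddCommGroup.induced _ _ (weighted s α p q) (weighted_injective s α p q)

noncomputable instance [Fact (1 ≤ q)] : NormedSpace ℝ (FracSpace s α p q) :=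
  NormedSpace.induced ℝ _ _ (weighted s α p q)

end Space

section Tensor
variable {X Y : Type*} [NormedAddCommGroup X] [NormedSpace ℝ X]
  [NormedAddCommGroup Y] [NormedSpace ℝ Y]

/-- The weak `ℓ_r`-norm
`sup { (∑ |ψ(gᵢ)| ^ r) ^ (1 / r) : ψ ∈ Y', ‖ψ‖ ≤ 1 }` of a finite family. -/
noncomputable def weakNorm (r : ℝ) {n : ℕ} (g : Fin n → Y) : ℝ :=
  sSup {w : ℝ | ∃ ψ : StrongDual ℝ Y, ‖ψ‖ ≤ 1 ∧ w = (∑ i, |ψ (g i)| ^ r) ^ (1 / r)}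

/-- The `p`-nuclear (left `p`-Chevet-Saphar) tensor norm `δ_p` on the algebraic tensor product,
where `p.conjExponent = p / (p - 1)` is the conjugate exponent. -/
noncomputable def pNuclearNorm (p : ℝ) (h : X ⊗[ℝ] Y) : ℝ :=
  sInf {r : ℝ | ∃ (n : ℕ) (f : Fin n → X) (g : Fin n → Y), h = ∑ i, f i ⊗ₜ[ℝ] g i ∧
    r = (∑ i, ‖f i‖ ^ p) ^ (1 / p) * weakNorm p.conjExponent g}

theorem weakNorm_bddAbove {r : ℝ} (hr : 0 < r) {n : ℕ} (g : Fin n → Y) :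
    BddAbove {w : ℝ | ∃ ψ : StrongDual ℝ Y, ‖ψ‖ ≤ 1 ∧ w = (∑ i, |ψ (g i)| ^ r) ^ (1 / r)} := by
  refine ⟨(∑ i, ‖g i‖ ^ r) ^ (1 / r), ?_⟩
  rintro w ⟨ψ, hψ, rfl⟩
  refine Real.rpow_le_rpow (Finset.sum_nonneg fun i _ => Real.rpow_nonneg (abs_nonneg _) _)
    (Finset.sum_le_sum fun i _ => Real.rpow_le_rpow (abs_nonneg _) ?_ hr.le) (by positivity)
  have := ψ.le_opNorm (g i)
  rw [Real.norm_eq_abs] at this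
  exact this.trans (mul_le_of_le_one_left (norm_nonneg _) hψ)

theorem le_weakNorm {r : ℝ} (hr : 0 < r) {n : ℕ} (g : Fin n → Y) {ψ : StrongDual ℝ Y}
    (hψ : ‖ψ‖ ≤ 1) : (∑ i, |ψ (g i)| ^ r) ^ (1 / r) ≤ weakNorm r g :=
  le_csSup (weakNorm_bddAbove hr g) ⟨ψ, hψ, rfl⟩

theorem weakNorm_nonneg {r : ℝ} (hr : 0 < r) {n : ℕ} (g : Fin n → Y) : 0 ≤ weakNorm r g :=
  (Real.rpow_nonneg (Finset.sum_nonneg fun i _ => Real.rpow_nonneg (abs_nonneg _) _) _).trans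
    (le_weakNorm hr g (ψ := 0) (by simp))

theorem pNuclear_nonempty (p : ℝ) (h : X ⊗[ℝ] Y) :
    {r : ℝ | ∃ (n : ℕ) (f : Fin n → X) (g : Fin n → Y), h = ∑ i, f i ⊗ₜ[ℝ] g i ∧
      r = (∑ i, ‖f i‖ ^ p) ^ (1 / p) * weakNorm p.conjExponent g}.Nonempty := by
  suffices ∃ (n : ℕ) (f : Fin n → X) (g : Fin n → Y), h = ∑ i, f i ⊗ₜ[ℝ] g i by
    obtain ⟨n, f, g, e⟩ := this
    exact ⟨_, n, f, g, e, rfl⟩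
  induction h with
  | zero => exact ⟨0, Fin.elim0, Fin.elim0, by simp⟩
  | tmul x y => exact ⟨1, fun _ => x, fun _ => y, by simp⟩
  | add a b ha hb =>
    obtain ⟨n, f, g, rfl⟩ := ha
    obtain ⟨m, f', g', rfl⟩ := hb
    exact ⟨n + m, Fin.append f f', Fin.append g g', by simp [Fin.sum_univ_add]⟩

theorem pNuclear_mem_nonneg {p : ℝ} (hp : 1 < p) (h : X ⊗[ℝ] Y) {r : ℝ}
    (hr : r ∈ {r : ℝ | ∃ (n : ℕ) (f : Fin n → X) (g : Fin n → Y), h = ∑ i, f i ⊗ₜ[ℝ] g i ∧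
      r = (∑ i, ‖f i‖ ^ p) ^ (1 / p) * weakNorm p.conjExponent g}) : 0 ≤ r := by
  obtain ⟨n, f, g, -, rfl⟩ := hr
  have := weakNorm_nonneg (Real.HolderConjugate.conjExponent hp).symm.pos g
  positivity

theorem pNuclearNorm_le {p : ℝ} (hp : 1 < p) {h : X ⊗[ℝ] Y} {n : ℕ} {f : Fin n → X}
    {g : Fin n → Y} (e : h = ∑ i, f i ⊗ₜ[ℝ] g i) :
    pNuclearNorm p h ≤ (∑ i, ‖f i‖ ^ p) ^ (1 / p) * weakNorm p.conjExponent g :=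
  csInf_le ⟨0, fun _ hr => pNuclear_mem_nonneg hp h hr⟩ ⟨n, f, g, e, rfl⟩

theorem pNuclearNorm_nonneg {p : ℝ} (hp : 1 < p) (h : X ⊗[ℝ] Y) : 0 ≤ pNuclearNorm p h :=
  le_csInf (pNuclear_nonempty p h) fun _ hr => pNuclear_mem_nonneg hp h hr

/-- Balanced representations. -/
theorem exists_balanced {p : ℝ} (hp : 1 < p) {h : X ⊗[ℝ] Y} {a : ℝ}
    (ha : pNuclearNorm p h < a) : ∃ (n : ℕ) (f : Fin n → X) (g : Fin n → Y),
      h = ∑ i, f i ⊗ₜ[ℝ] g i ∧ ∑ i, ‖f i‖ ^ p ≤ a ∧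
      ∀ ψ : StrongDual ℝ Y, ‖ψ‖ ≤ 1 → ∑ i, |ψ (g i)| ^ p.conjExponent ≤ a := by
  have hpq := Real.HolderConjugate.conjExponent hp
  set q := p.conjExponent with hq
  have hp0 := hpq.pos
  have hq0 := hpq.symm.pos
  have ha0 : 0 < a := (pNuclearNorm_nonneg hp h).trans_lt ha
  obtain ⟨_, ⟨n, f, g, rfl, rfl⟩, hlt⟩ := exists_lt_of_csInf_lt (pNuclear_nonempty p h) ha
  set A := (∑ i, ‖f i‖ ^ p) ^ (1 / p) with hA
  set B := weakNorm q g with hB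
  have hA0 : 0 ≤ A := by positivity
  have hB0 : 0 ≤ B := weakNorm_nonneg hq0 g
  have hsplit : a ^ (1 / p) * a ^ (1 / q) = a := by
    rw [← Real.rpow_add ha0, one_div, one_div, hpq.inv_add_inv_eq_one, Real.rpow_one]
  obtain ⟨l, hl, h1, h2⟩ : ∃ l : ℝ, 0 < l ∧ l * A ≤ a ^ (1 / p) ∧ l⁻¹ * B ≤ a ^ (1 / q) := by
    have hx : 0 < a ^ (1 / p) := by positivity
    have hy : 0 < a ^ (1 / q) := by positivity
    rcases hA0.eq_or_lt with hA' | hA'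
    · refine ⟨(B + 1) / a ^ (1 / q), by positivity, by rw [← hA', mul_zero]; exact hx.le, ?_⟩
      rw [inv_div, div_mul_eq_mul_div, div_le_iff₀ (by positivity)]
      nlinarith
    · refine ⟨a ^ (1 / p) / A, by positivity, by rw [div_mul_cancel₀ _ hA'.ne'], ?_⟩
      rw [inv_div, div_mul_eq_mul_div, div_le_iff₀ hx, mul_comm (a ^ (1 / q)), hsplit]
      exact hlt.le
  refine ⟨n, fun i => l • f i, fun i => l⁻¹ • g i, ?_, ?_, fun ψ hψ => ?_⟩
  · refine Finset.sum_congr rfl fun i _ => ?_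
    rw [TensorProduct.smul_tmul_smul, mul_inv_cancel₀ hl.ne', one_smul]
  · have e : ∑ i, ‖l • f i‖ ^ p = (l * A) ^ p := by
      rw [Real.mul_rpow hl.le hA0, hA, ← Real.rpow_mul (by positivity),
        one_div_mul_cancel hp0.ne', Real.rpow_one, Finset.mul_sum]
      refine Finset.sum_congr rfl fun i _ => ?_
      rw [norm_smul, Real.norm_of_nonneg hl.le, Real.mul_rpow hl.le (norm_nonneg _)]
    rw [e]
    calc (l * A) ^ p ≤ (a ^ (1 / p)) ^ p := Real.rpow_le_rpow (by positivity) h1 hp0.le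
      _ = a := by rw [← Real.rpow_mul ha0.le, one_div_mul_cancel hp0.ne', Real.rpow_one]
  · have hs : 0 ≤ ∑ i, |ψ (g i)| ^ q := by positivity
    have e : ∑ i, |ψ (l⁻¹ • g i)| ^ q = (l⁻¹ * (∑ i, |ψ (g i)| ^ q) ^ (1 / q)) ^ q := by
      rw [Real.mul_rpow (by positivity) (by positivity), ← Real.rpow_mul hs,
        one_div_mul_cancel hq0.ne', Real.rpow_one, Finset.mul_sum]
      refine Finset.sum_congr rfl fun i _ => ?_
      rw [map_smul, smul_eq_mul, abs_mul, abs_of_pos (inv_pos.2 hl),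
        Real.mul_rpow (by positivity) (abs_nonneg _)]
    rw [e]
    calc (l⁻¹ * (∑ i, |ψ (g i)| ^ q) ^ (1 / q)) ^ q ≤ (a ^ (1 / q)) ^ q := by
          refine Real.rpow_le_rpow (by positivity) (le_trans ?_ h2) hq0.le
          exact mul_le_mul_of_nonneg_left (le_weakNorm hq0 g hψ) (by positivity)
      _ = a := by rw [← Real.rpow_mul ha0.le, one_div_mul_cancel hq0.ne', Real.rpow_one]

theorem pNuclearNorm_le_of_balanced {p : ℝ} (hp : 1 < p) {h : X ⊗[ℝ] Y} {a : ℝ} (ha : 0 < a)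
    {n : ℕ} {f : Fin n → X} {g : Fin n → Y} (e : h = ∑ i, f i ⊗ₜ[ℝ] g i)
    (hf : ∑ i, ‖f i‖ ^ p ≤ a)
    (hg : ∀ ψ : StrongDual ℝ Y, ‖ψ‖ ≤ 1 → ∑ i, |ψ (g i)| ^ p.conjExponent ≤ a) :
    pNuclearNorm p h ≤ a := by
  have hpq := Real.HolderConjugate.conjExponent hp
  have hp0 := hpq.pos
  have hq0 := hpq.symm.pos
  refine (pNuclearNorm_le hp e).trans ?_
  calc _ ≤ a ^ (1 / p) * a ^ (1 / p.conjExponent) := by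
        refine mul_le_mul (Real.rpow_le_rpow (by positivity) hf (by positivity)) ?_
          (weakNorm_nonneg hq0 g) (by positivity)
        refine csSup_le ⟨_, 0, by simp, rfl⟩ ?_
        rintro w ⟨ψ, hψ, rfl⟩
        exact Real.rpow_le_rpow (by positivity) (hg ψ hψ) (by positivity)
    _ = a := by
        rw [← Real.rpow_add ha, one_div, one_div, hpq.inv_add_inv_eq_one, Real.rpow_one]

theorem pNuclearNorm_add_le {p : ℝ} (hp : 1 < p) (h k : X ⊗[ℝ] Y) :
    pNuclearNorm p (h + k) ≤ pNuclearNorm p h + pNuclearNorm p k := by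
  refine le_of_forall_pos_le_add fun ε hε => ?_
  obtain ⟨n, f, g, e, hf, hg⟩ := exists_balanced hp (h := h)
    (a := pNuclearNorm p h + ε / 2) (by linarith)
  obtain ⟨m, f', g', e', hf', hg'⟩ := exists_balanced hp (h := k)
    (a := pNuclearNorm p k + ε / 2) (by linarith)
  have h0 := pNuclearNorm_nonneg hp h
  have k0 := pNuclearNorm_nonneg hp k
  refine pNuclearNorm_le_of_balanced hp (by linarith) (n := n + m) (f := Fin.append f f')
    (g := Fin.append g g') (by simp [Fin.sum_univ_add, e, e']) ?_ fun ψ hψ => ?_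
  · simp only [Fin.sum_univ_add, Fin.append_left, Fin.append_right]
    linarith
  · have := hg ψ hψ
    have := hg' ψ hψ
    simp only [Fin.sum_univ_add, Fin.append_left, Fin.append_right]
    linarith

theorem pNuclearNorm_smul_le {p : ℝ} (hp : 1 < p) {c : ℝ} (hc : c ≠ 0) (h : X ⊗[ℝ] Y) :
    pNuclearNorm p (c • h) ≤ |c| * pNuclearNorm p h := by
  have hp0 : 0 < p := by linarith
  have hc' : 0 < |c| := abs_pos.2 hc
  rw [← div_le_iff₀' hc']
  refine le_csInf (pNuclear_nonempty p h) ?_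
  rintro _ ⟨n, f, g, rfl, rfl⟩
  rw [div_le_iff₀' hc']
  refine (pNuclearNorm_le hp (f := fun i => c • f i) (g := g)
    (by simp [Finset.smul_sum, TensorProduct.smul_tmul'])).trans (le_of_eq ?_)
  rw [← mul_assoc]
  congr 1
  have e : ∑ i, ‖c • f i‖ ^ p = |c| ^ p * ∑ i, ‖f i‖ ^ p := by
    rw [Finset.mul_sum]
    refine Finset.sum_congr rfl fun i _ => ?_
    rw [norm_smul, Real.norm_eq_abs, Real.mul_rpow (abs_nonneg _) (norm_nonneg _)]
  rw [e, Real.mul_rpow (by positivity) (by positivity), ← Real.rpow_mul (abs_nonneg _),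
    mul_one_div_cancel hp0.ne', Real.rpow_one]

theorem pNuclearNorm_smul {p : ℝ} (hp : 1 < p) (c : ℝ) (h : X ⊗[ℝ] Y) :
    pNuclearNorm p (c • h) = ‖c‖ * pNuclearNorm p h := by
  rw [Real.norm_eq_abs]
  rcases eq_or_ne c 0 with rfl | hc
  · rw [zero_smul, abs_zero, zero_mul]
    refine le_antisymm ?_ (pNuclearNorm_nonneg hp _)
    refine (pNuclearNorm_le hp (n := 0) (f := Fin.elim0) (g := Fin.elim0) (by simp)).trans ?_
    have : p ≠ 0 := by linarith
    simp [Real.zero_rpow (inv_ne_zero this)]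
  · refine le_antisymm (pNuclearNorm_smul_le hp hc h) ?_
    have := pNuclearNorm_smul_le hp (inv_ne_zero hc) (c • h)
    rw [smul_smul, inv_mul_cancel₀ hc, one_smul, abs_inv] at this
    rwa [← div_eq_inv_mul, le_div_iff₀' (abs_pos.2 hc)] at this
end Tensor

/-- The algebraic tensor product `X ⊗ Y`, equipped with the `p`-nuclear tensor norm `δ_p`. -/
def AlgTensor (_p : ℝ) (X Y : Type*) [NormedAddCommGroup X] [NormedSpace ℝ X]
    [NormedAddCommGroup Y] [NormedSpace ℝ Y] : Type _ :=
  X ⊗[ℝ] Y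

section
variable (p : ℝ) (X Y : Type*) [NormedAddCommGroup X] [NormedSpace ℝ X]
  [NormedAddCommGroup Y] [NormedSpace ℝ Y]

noncomputable instance : AddCommGroup (AlgTensor p X Y) :=
  inferInstanceAs (AddCommGroup (X ⊗[ℝ] Y))

noncomputable instance : Module ℝ (AlgTensor p X Y) :=
  inferInstanceAs (Module ℝ (X ⊗[ℝ] Y))

noncomputable instance : Norm (AlgTensor p X Y) := ⟨fun h => pNuclearNorm p (X := X) (Y := Y) h⟩

theorem AlgTensor.core [hp : Fact (1 < p)] : SeminormedSpace.Core ℝ (AlgTensor p X Y) where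
  norm_nonneg h := pNuclearNorm_nonneg (X := X) (Y := Y) hp.out h
  norm_smul c h := pNuclearNorm_smul (X := X) (Y := Y) hp.out c h
  norm_triangle h k := pNuclearNorm_add_le (X := X) (Y := Y) hp.out h k

noncomputable instance [Fact (1 < p)] : SeminormedAddCommGroup (AlgTensor p X Y) :=
  SeminormedAddCommGroup.ofCore (AlgTensor.core p X Y)

noncomputable instance [Fact (1 < p)] : NormedSpace ℝ (AlgTensor p X Y) where
  norm_smul_le c h := ((AlgTensor.core p X Y).norm_smul c h).le

/-- The `p`-nuclear tensor product `X ⊗_{δ_p} Y`: the completion of the algebraic tensor product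
with respect to `δ_p`. -/
abbrev NuclearTensor [Fact (1 < p)] : Type _ := UniformSpace.Completion (AlgTensor p X Y)

end

/-- The elementary tensor `x ⊗ y` in `X ⊗_{δ_p} Y`. -/
noncomputable def NuclearTensor.tmul (p : ℝ) [Fact (1 < p)] {X Y : Type*} [NormedAddCommGroup X]
    [NormedSpace ℝ X] [NormedAddCommGroup Y] [NormedSpace ℝ Y] (x : X) (y : Y) :
    NuclearTensor p X Y :=
  UniformSpace.Completion.coe' (show AlgTensor p X Y from x ⊗ₜ[ℝ] y)

end FracSmooth

namespace FracSmooth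

/-! ### Functoriality of the weak norm and of the `p`-nuclear norm -/

section NuclearNorm
variable {X Y X' Y' : Type*} [NormedAddCommGroup X] [NormedSpace ℝ X]
  [NormedAddCommGroup Y] [NormedSpace ℝ Y] [NormedAddCommGroup X'] [NormedSpace ℝ X']
  [NormedAddCommGroup Y'] [NormedSpace ℝ Y']

/-! The core is that, for finite measures, `δ_p` on `L_p(μ) ⊗ L_p(ν)` is exactly the norm of `L_p(μ
× ν)`. Read `∑ f_i ⊗ g_i` as the `L_p(ν)`-valued function `s ↦ ∑ f_i(s) g_i`. Testing with a norming
functional and applying Hölder bounds its norm at `s` by `(∑ |f_i(s)|^p)^(1/p)` times the weak norm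
of `g`; integrating `p`-th powers gives `norm_prodMap_le`. Conversely, if the second factors are
normalised indicators of disjoint sets, their weak `ℓ_{p'}`-norm is at most one and the strong
`ℓ_p`-norm of the first factors is the `L_p`-norm on the product. Approximation by simple functions
extends this to all tensors (`pNuclearNorm_le_norm_prodMap`).

By `densitiesL`, a space of fractional smoothness is, for every `q`, isomorphic to the finite direct
sum of the `L_p([0,1]^u)`. Since `δ_p` is compatible with bounded operators on the factors
(`pNuclearNorm_map_le`), a tensor product of two such sums can be estimated block by block. A set
`v` of `N + m` coordinates is the same as a pair of sets, one among the first `N` and one among the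
last `m`, so the blocks are dense in the `L_p([0,1]^v)`. The kernel of `v` is the product of the
kernels of its parts, and Fubini shows that the densities of `f(x) g(y)` are the products of the
densities of `f` and `g` (`Phi_toDensities_tmul`).

Hence `toDensities` is bounded above and below with respect to `δ_p` and has dense range, so it
extends to an isomorphism of the completion onto the densities in `N + m` variables. The theorem is
the case `m = 1`. -/

theorem weakNorm_le {r : ℝ} {n : ℕ} {g : Fin n → Y} {C : ℝ}
    (h : ∀ ψ : StrongDual ℝ Y, ‖ψ‖ ≤ 1 → (∑ i, |ψ (g i)| ^ r) ^ (1 / r) ≤ C) :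
    weakNorm r g ≤ C := by
  refine csSup_le ⟨_, 0, by simp, rfl⟩ ?_
  rintro w ⟨ψ, hψ, rfl⟩
  exact h ψ hψ

theorem rpow_sum_smul {r : ℝ} (hr : 0 < r) {n : ℕ} {c : ℝ} (hc : 0 ≤ c) {a : Fin n → ℝ}
    (ha : ∀ i, 0 ≤ a i) :
    (∑ i, (c * a i) ^ r) ^ (1 / r) = c * (∑ i, a i ^ r) ^ (1 / r) := by
  simp_rw [fun i => Real.mul_rpow (z := r) hc (ha i)]
  rw [← Finset.mul_sum, Real.mul_rpow (by positivity)
    (Finset.sum_nonneg fun i _ => Real.rpow_nonneg (ha i) _), ← Real.rpow_mul hc,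
    mul_one_div_cancel hr.ne', Real.rpow_one]

/-- Homogeneous form of `le_weakNorm`, obtained by normalising the functional. It is needed for
functionals `ψ ∘ B`, whose norm is not controlled by one. -/
theorem rpow_sum_dual_le {r : ℝ} (hr : 0 < r) {n : ℕ} (g : Fin n → Y) (φ : StrongDual ℝ Y) :
    (∑ i, |φ (g i)| ^ r) ^ (1 / r) ≤ ‖φ‖ * weakNorm r g := by
  rcases eq_or_ne φ 0 with rfl | hφ
  · simp [Real.zero_rpow hr.ne', Real.zero_rpow (inv_ne_zero hr.ne')]
  have hφ' : 0 < ‖φ‖ := norm_pos_iff.2 hφ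
  have h := le_weakNorm hr g (ψ := ‖φ‖⁻¹ • φ)
    (by rw [norm_smul, norm_inv, norm_norm, inv_mul_cancel₀ hφ'.ne'])
  have e : ∀ i, |(‖φ‖⁻¹ • φ) (g i)| = ‖φ‖⁻¹ * |φ (g i)| := fun i => by
    rw [smul_apply, smul_eq_mul, abs_mul, abs_of_pos (inv_pos.2 hφ')]
  simp_rw [e] at h
  rwa [rpow_sum_smul hr (inv_nonneg.2 hφ'.le) fun i => abs_nonneg _,
    inv_mul_le_iff₀ hφ'] at h

theorem weakNorm_map_le {r : ℝ} (hr : 0 < r) {n : ℕ} (g : Fin n → Y) (B : Y →L[ℝ] Y') :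
    weakNorm r (fun i => B (g i)) ≤ ‖B‖ * weakNorm r g :=
  weakNorm_le fun ψ hψ => (rpow_sum_dual_le hr g (ψ.comp B)).trans <|
    mul_le_mul_of_nonneg_right ((ψ.opNorm_comp_le B).trans
      (mul_le_of_le_one_left (norm_nonneg _) hψ)) (weakNorm_nonneg hr g)

/-- A family that satisfies an upper `p`-estimate has weak `ℓ_{p'}`-norm at most one. -/
theorem weakNorm_le_one {p : ℝ} (hp : 1 < p) {n : ℕ} {g : Fin n → Y}
    (h : ∀ a : Fin n → ℝ, ∑ i, |a i| ^ p ≤ 1 → ‖∑ i, a i • g i‖ ≤ 1) :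
    weakNorm p.conjExponent g ≤ 1 := by
  have hpq := Real.HolderConjugate.conjExponent hp
  refine weakNorm_le fun ψ hψ => ?_
  -- Duality of `ℓ_{p'}` and `ℓ_p`: some `b ≥ 0` in the unit ball of `ℓ_p` attains the `ℓ_{p'}`-norm
  -- of `(ψ (g i))`.
  obtain ⟨b, hb, hb'⟩ := (NNReal.isGreatest_Lp (fun i => ‖ψ (g i)‖₊) hpq.symm
    (s := Finset.univ)).1
  have hb'' := congrArg ((↑) : NNReal → ℝ) hb'
  have hb1 : ((∑ i, b i ^ p : NNReal) : ℝ) ≤ 1 := by exact_mod_cast hb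
  push_cast at hb'' hb1
  simp only [Real.norm_eq_abs] at hb''
  rw [← hb'']
  -- Putting the signs into the coefficients turns the pairing into one value of `ψ`, to which the
  -- upper `p`-estimate applies.
  have e : ∑ i, |ψ (g i)| * (b i : ℝ) = ψ (∑ i, (SignType.sign (ψ (g i)) * b i : ℝ) • g i) := by
    simp only [map_sum, map_smul, smul_eq_mul]
    refine Finset.sum_congr rfl fun i _ => ?_
    rw [mul_right_comm, sign_mul_self]
  rw [e]
  refine (le_abs_self _).trans ((ψ.le_opNorm _).trans ?_)
  refine mul_le_one₀ hψ (norm_nonneg _) (h _ (le_trans ?_ hb1))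
  refine Finset.sum_le_sum fun i _ => ?_
  refine Real.rpow_le_rpow (abs_nonneg _) ?_ hpq.pos.le
  rw [abs_mul, NNReal.abs_eq]
  refine mul_le_of_le_one_left (b i).2 ?_
  rcases lt_trichotomy (ψ (g i)) 0 with h | h | h <;> simp [h]

/-- Applying `A` and `B` termwise turns each representation of `h` into one of its image. This is
what allows passage between tensors of functions and tensors of densities. -/
theorem pNuclearNorm_map_le {p : ℝ} (hp : 1 < p) (A : X →L[ℝ] X') (B : Y →L[ℝ] Y')
    (h : X ⊗[ℝ] Y) :
    pNuclearNorm p (TensorProduct.map A.toLinearMap B.toLinearMap h) ≤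
      ‖A‖ * ‖B‖ * pNuclearNorm p h := by
  have hpq := Real.HolderConjugate.conjExponent hp
  have key : ∀ r ∈ {r : ℝ | ∃ (n : ℕ) (f : Fin n → X) (g : Fin n → Y),
      h = ∑ i, f i ⊗ₜ[ℝ] g i ∧ r = (∑ i, ‖f i‖ ^ p) ^ (1 / p) * weakNorm p.conjExponent g},
      pNuclearNorm p (TensorProduct.map A.toLinearMap B.toLinearMap h) ≤ ‖A‖ * ‖B‖ * r := by
    rintro _ ⟨n, f, g, rfl, rfl⟩
    refine (pNuclearNorm_le hp (f := fun i => A (f i)) (g := fun i => B (g i))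
      (by simp)).trans ?_
    have h1 : (∑ i, ‖A (f i)‖ ^ p) ^ (1 / p) ≤ ‖A‖ * (∑ i, ‖f i‖ ^ p) ^ (1 / p) := by
      rw [← rpow_sum_smul hpq.pos (norm_nonneg _) fun i => norm_nonneg _]
      have := hpq.pos
      gcongr
      exact A.le_opNorm _
    calc _ ≤ (‖A‖ * (∑ i, ‖f i‖ ^ p) ^ (1 / p)) * (‖B‖ * weakNorm p.conjExponent g) :=
          mul_le_mul h1 (weakNorm_map_le hpq.symm.pos g B) (weakNorm_nonneg hpq.symm.pos _)
            (by positivity)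
      _ = _ := by ring
  -- Passing to the infimum over `r` divides by `‖A‖ * ‖B‖`; if this vanishes, a single
  -- representation suffices.
  rcases (mul_nonneg (norm_nonneg A) (norm_nonneg B)).eq_or_lt with h0 | h0
  · obtain ⟨r, hr⟩ := pNuclear_nonempty p h
    have := key r hr
    rwa [← h0, zero_mul] at this ⊢
  · rw [← div_le_iff₀' h0]
    refine le_csInf (pNuclear_nonempty p h) fun r hr => ?_
    rw [div_le_iff₀' h0]
    exact key r hr

theorem pNuclearNorm_tmul_le {p : ℝ} (hp : 1 < p) (f : X) (g : Y) :
    pNuclearNorm p (f ⊗ₜ[ℝ] g) ≤ ‖f‖ * ‖g‖ := by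
  have hpq := Real.HolderConjugate.conjExponent hp
  refine (pNuclearNorm_le hp (n := 1) (f := fun _ => f) (g := fun _ => g) (by simp)).trans ?_
  have e : ∀ {r a : ℝ}, 0 < r → 0 ≤ a → (a ^ r) ^ (1 / r) = a := fun hr ha => by
    rw [← Real.rpow_mul ha, mul_one_div_cancel hr.ne', Real.rpow_one]
  rw [Fin.sum_univ_one, e hpq.pos (norm_nonneg _)]
  gcongr
  refine weakNorm_le fun ψ hψ => ?_
  rw [Fin.sum_univ_one, e hpq.symm.pos (abs_nonneg _)]
  exact (ψ.le_opNorm g).trans (mul_le_of_le_one_left (norm_nonneg _) hψ)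

theorem pNuclearNorm_sum_le {p : ℝ} (hp : 1 < p) {ι : Type*} (s : Finset ι) (h : ι → X ⊗[ℝ] Y) :
    pNuclearNorm p (∑ i ∈ s, h i) ≤ ∑ i ∈ s, pNuclearNorm p (h i) := by
  classical
  induction s using Finset.induction_on with
  | empty => simpa using (pNuclearNorm_smul hp 0 (0 : X ⊗[ℝ] Y)).le
  | insert a s ha ih =>
    rw [Finset.sum_insert ha, Finset.sum_insert ha]
    exact (pNuclearNorm_add_le hp _ _).trans (by gcongr)

end NuclearNorm

/-! ### The map `L_p(μ) ⊗ L_p(ν) → L_p(μ × ν)` and its contractivity -/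

section ProductMeasure

theorem Lp_coeFn_sum {S : Type*} [MeasurableSpace S] {P : ℝ≥0∞} {μ : Measure S} {ι : Type*}
    (s : Finset ι) (f : ι → Lp ℝ P μ) : ⇑(∑ i ∈ s, f i) =ᵐ[μ] fun t => ∑ i ∈ s, f i t := by
  classical
  induction s using Finset.induction_on with
  | empty =>
    filter_upwards [Lp.coeFn_zero ℝ P μ] with t ht
    rw [Finset.sum_empty, Finset.sum_empty]
    exact ht
  | insert a s ha ih =>
    rw [Finset.sum_insert ha]
    filter_upwards [Lp.coeFn_add (f a) (∑ i ∈ s, f i), ih] with t h1 h2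
    rw [h1, Pi.add_apply, h2, Finset.sum_insert ha]

theorem Lp_coeFn_sum_smul {S : Type*} [MeasurableSpace S] {P : ℝ≥0∞} {μ : Measure S} {n : ℕ}
    (a : Fin n → ℝ) (f : Fin n → Lp ℝ P μ) :
    ⇑(∑ i, a i • f i) =ᵐ[μ] fun t => ∑ i, a i * f i t := by
  have h : ∀ᵐ t ∂μ, ∀ i, (a i • f i : Lp ℝ P μ) t = a i * f i t :=
    ae_all_iff.2 fun i => Lp.coeFn_smul (a i) (f i)
  filter_upwards [Lp_coeFn_sum Finset.univ fun i => a i • f i, h] with t h1 h2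
  rw [h1]
  exact Finset.sum_congr rfl fun i _ => h2 i

variable {S T : Type*} [MeasurableSpace S] [MeasurableSpace T] {μ : Measure S} {ν : Measure T}
  {p : ℝ} [hp : Fact (1 < p)]

theorem ofReal_ne_zero_of_fact (p : ℝ) [hp : Fact (1 < p)] : ENNReal.ofReal p ≠ 0 := by
  have := hp.out
  simp only [ne_eq, ENNReal.ofReal_eq_zero, not_le]
  linarith

theorem toReal_ofReal_of_fact (p : ℝ) [hp : Fact (1 < p)] : (ENNReal.ofReal p).toReal = p :=
  ENNReal.toReal_ofReal (zero_le_one.trans hp.out.le)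

theorem MemLp_integrable_rpow {f : S → ℝ} (hf : MemLp f (ENNReal.ofReal p) μ) :
    Integrable (fun s => |f s| ^ p) μ := by
  have := hf.integrable_norm_rpow (ofReal_ne_zero_of_fact p) ENNReal.ofReal_ne_top
  rwa [toReal_ofReal_of_fact] at this

theorem MemLp_of_integrable_rpow {f : S → ℝ} (hf : AEStronglyMeasurable f μ)
    (h : Integrable (fun s => |f s| ^ p) μ) : MemLp f (ENNReal.ofReal p) μ := by
  refine (integrable_norm_rpow_iff hf (ofReal_ne_zero_of_fact p) ENNReal.ofReal_ne_top).1 ?_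
  rwa [toReal_ofReal_of_fact]

theorem Lp_norm_rpow (f : Lp ℝ (ENNReal.ofReal p) μ) : ‖f‖ ^ p = ∫ s, |f s| ^ p ∂μ := by
  have h0 : 0 < p := zero_lt_one.trans hp.out
  have h1 : 0 ≤ ∫ s, |f s| ^ p ∂μ := integral_nonneg fun s => by positivity
  rw [Lp.norm_def, (Lp.memLp f).eLpNorm_eq_integral_rpow_norm (ofReal_ne_zero_of_fact p)
    ENNReal.ofReal_ne_top]
  simp only [Real.norm_eq_abs, toReal_ofReal_of_fact p]
  rw [ENNReal.toReal_ofReal (by positivity), ← Real.rpow_mul h1, inv_mul_cancel₀ h0.ne',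
    Real.rpow_one]

theorem Lp_norm_rpow_congr {f : Lp ℝ (ENNReal.ofReal p) μ} {g : S → ℝ} (h : f =ᵐ[μ] g) :
    ‖f‖ ^ p = ∫ s, |g s| ^ p ∂μ := by
  rw [Lp_norm_rpow]
  refine integral_congr_ae ?_
  filter_upwards [h] with s hs
  rw [hs]

theorem MemLp_mul_prod {f : S → ℝ} {g : T → ℝ} (hf : MemLp f (ENNReal.ofReal p) μ)
    (hg : MemLp g (ENNReal.ofReal p) ν) :
    MemLp (fun z : S × T => f z.1 * g z.2) (ENNReal.ofReal p) (μ.prod ν) := by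
  refine MemLp_of_integrable_rpow
    (hf.aestronglyMeasurable.comp_fst.mul hg.aestronglyMeasurable.comp_snd) ?_
  refine ((MemLp_integrable_rpow hf).mul_prod (MemLp_integrable_rpow hg)).congr
    (Filter.Eventually.of_forall fun z => ?_)
  simp only
  rw [abs_mul, Real.mul_rpow (abs_nonneg _) (abs_nonneg _)]

/-- The function `(s, t) ↦ f s * g t` as an element of `L_p(μ × ν)`. -/
noncomputable def prodMul (f : Lp ℝ (ENNReal.ofReal p) μ) (g : Lp ℝ (ENNReal.ofReal p) ν) :
    Lp ℝ (ENNReal.ofReal p) (μ.prod ν) :=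
  (MemLp_mul_prod (Lp.memLp f) (Lp.memLp g)).toLp _

theorem coeFn_prodMul (f : Lp ℝ (ENNReal.ofReal p) μ) (g : Lp ℝ (ENNReal.ofReal p) ν) :
    prodMul f g =ᵐ[μ.prod ν] fun z => f z.1 * g z.2 :=
  MemLp.coeFn_toLp _

theorem prodMul_congr {f : Lp ℝ (ENNReal.ofReal p) μ} {g : Lp ℝ (ENNReal.ofReal p) ν}
    {f' : S → ℝ} {g' : T → ℝ} (hf : f =ᵐ[μ] f') (hg : g =ᵐ[ν] g') :
    prodMul f g =ᵐ[μ.prod ν] fun z => f' z.1 * g' z.2 := by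
  filter_upwards [coeFn_prodMul f g, Measure.quasiMeasurePreserving_fst.ae hf,
    Measure.quasiMeasurePreserving_snd.ae hg] with z h h1 h2
  rw [h, h1, h2]

/-- The canonical map `L_p(μ) ⊗ L_p(ν) → L_p(μ × ν)`. -/
noncomputable def prodMap (p : ℝ) [Fact (1 < p)] (μ : Measure S) (ν : Measure T) :
    Lp ℝ (ENNReal.ofReal p) μ ⊗[ℝ] Lp ℝ (ENNReal.ofReal p) ν →ₗ[ℝ]
      Lp ℝ (ENNReal.ofReal p) (μ.prod ν) :=
  TensorProduct.lift <| LinearMap.mk₂ ℝ prodMul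
    (fun f f' g => by
      ext1
      filter_upwards [prodMul_congr (Lp.coeFn_add f f') (ae_eq_refl g), coeFn_prodMul f g,
        coeFn_prodMul f' g, Lp.coeFn_add (prodMul f g) (prodMul f' g)] with z h h1 h2 h3
      rw [h, h3, Pi.add_apply, Pi.add_apply, h1, h2, add_mul])
    (fun c f g => by
      ext1
      filter_upwards [prodMul_congr (Lp.coeFn_smul c f) (ae_eq_refl g), coeFn_prodMul f g,
        Lp.coeFn_smul c (prodMul f g)] with z h h1 h2
      rw [h, h2, Pi.smul_apply, Pi.smul_apply, h1, smul_eq_mul, smul_eq_mul, mul_assoc])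
    (fun f g g' => by
      ext1
      filter_upwards [prodMul_congr (ae_eq_refl f) (Lp.coeFn_add g g'), coeFn_prodMul f g,
        coeFn_prodMul f g', Lp.coeFn_add (prodMul f g) (prodMul f g')] with z h h1 h2 h3
      rw [h, h3, Pi.add_apply, Pi.add_apply, h1, h2, mul_add])
    (fun c f g => by
      ext1
      filter_upwards [prodMul_congr (ae_eq_refl f) (Lp.coeFn_smul c g), coeFn_prodMul f g,
        Lp.coeFn_smul c (prodMul f g)] with z h h1 h2
      rw [h, h2, Pi.smul_apply, Pi.smul_apply, h1, smul_eq_mul, smul_eq_mul, mul_left_comm])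

theorem prodMap_tmul (f : Lp ℝ (ENNReal.ofReal p) μ) (g : Lp ℝ (ENNReal.ofReal p) ν) :
    prodMap p μ ν (f ⊗ₜ g) = prodMul f g := rfl

theorem prodMap_sum_coeFn {n : ℕ} (f : Fin n → Lp ℝ (ENNReal.ofReal p) μ)
    (g : Fin n → Lp ℝ (ENNReal.ofReal p) ν) :
    prodMap p μ ν (∑ i, f i ⊗ₜ g i) =ᵐ[μ.prod ν] fun z => ∑ i, f i z.1 * g i z.2 := by
  rw [map_sum]
  have h : ∀ᵐ z ∂μ.prod ν, ∀ i, prodMul (f i) (g i) z = f i z.1 * g i z.2 :=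
    ae_all_iff.2 fun i => coeFn_prodMul (f i) (g i)
  filter_upwards [Lp_coeFn_sum Finset.univ fun i => prodMap p μ ν (f i ⊗ₜ g i), h] with z h1 h2
  rw [h1]
  exact Finset.sum_congr rfl fun i _ => h2 i

variable [SFinite μ] [SFinite ν]

/-- By Fubini, the function on the product may be viewed as an `L_p(ν)`-valued function of `s`. Both
comparisons of norms start from this formula. -/
theorem norm_prodMap_rpow {n : ℕ} (f : Fin n → Lp ℝ (ENNReal.ofReal p) μ)
    (g : Fin n → Lp ℝ (ENNReal.ofReal p) ν) :
    ‖prodMap p μ ν (∑ i, f i ⊗ₜ g i)‖ ^ p = ∫ s, ‖∑ i, f i s • g i‖ ^ p ∂μ := by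
  have hc := prodMap_sum_coeFn f g
  rw [Lp_norm_rpow_congr hc, integral_prod]
  · refine integral_congr_ae (Filter.Eventually.of_forall fun s => ?_)
    exact (Lp_norm_rpow_congr (Lp_coeFn_sum_smul (fun i => f i s) g)).symm
  · exact MemLp_integrable_rpow ((memLp_congr_ae hc).1 (Lp.memLp _))

/-- The `L_p`-norm on the product is dominated by the `p`-nuclear norm. -/
theorem norm_prodMap_le (h : Lp ℝ (ENNReal.ofReal p) μ ⊗[ℝ] Lp ℝ (ENNReal.ofReal p) ν) :
    ‖prodMap p μ ν h‖ ≤ pNuclearNorm p h := by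
  refine le_csInf (pNuclear_nonempty p h) ?_
  rintro _ ⟨n, f, g, rfl, rfl⟩
  have hpq := Real.HolderConjugate.conjExponent hp.out
  set W := weakNorm p.conjExponent g
  have hW : 0 ≤ W := weakNorm_nonneg hpq.symm.pos g
  have hp0 := hpq.pos
  have hpt : ∀ s, ‖∑ i, f i s • g i‖ ^ p ≤ W ^ p * ∑ i, |f i s| ^ p := fun s => by
    -- The norming functional depends on `s`, but it enters only a pointwise bound that no longer
    -- involves it, so no measurable choice is needed.
    obtain ⟨ψ, hψ, hψ'⟩ := exists_dual_vector'' ℝ (∑ i, f i s • g i)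
    have h1 : ‖∑ i, f i s • g i‖ ≤ (∑ i, |f i s| ^ p) ^ (1 / p) * W := by
      have h2 : ‖∑ i, f i s • g i‖ = ∑ i, f i s * ψ (g i) := by
        simpa using hψ'.symm
      rw [h2]
      refine (Real.inner_le_Lp_mul_Lq _ _ _ hpq).trans ?_
      gcongr
      exact le_weakNorm hpq.symm.pos g hψ
    calc _ ≤ ((∑ i, |f i s| ^ p) ^ (1 / p) * W) ^ p := by gcongr
      _ = _ := by
        rw [Real.mul_rpow (by positivity) hW, ← Real.rpow_mul (by positivity),
          one_div_mul_cancel hp0.ne', Real.rpow_one, mul_comm]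
  have hint : Integrable (fun s => ∑ i, |f i s| ^ p) μ :=
    integrable_finsetSum _ fun i _ => MemLp_integrable_rpow (Lp.memLp (f i))
  have key : ‖prodMap p μ ν (∑ i, f i ⊗ₜ g i)‖ ^ p ≤ W ^ p * ∑ i, ‖f i‖ ^ p := by
    rw [norm_prodMap_rpow]
    refine (integral_mono_of_nonneg (Filter.Eventually.of_forall fun s => by positivity)
      (hint.const_mul (W ^ p)) (Filter.Eventually.of_forall hpt)).trans (le_of_eq ?_)
    rw [integral_const_mul, integral_finsetSum _ fun i _ => MemLp_integrable_rpow (Lp.memLp (f i))]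
    simp_rw [Lp_norm_rpow]
  rw [← Real.rpow_le_rpow_iff (norm_nonneg _) (by positivity) hp0]
  refine key.trans (le_of_eq ?_)
  rw [Real.mul_rpow (by positivity) hW, ← Real.rpow_mul (by positivity),
          one_div_mul_cancel hp0.ne', Real.rpow_one, mul_comm]

end ProductMeasure

/-! ### The reverse inequality via simple functions, and density of the tensors -/

section Simple

theorem abs_sum_indicator_rpow {T : Type*} {p : ℝ} (hp : p ≠ 0) {n : ℕ} {B : Fin n → Set T}
    (hB : Pairwise (Function.onFun Disjoint B)) (a : Fin n → ℝ) (t : T) :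
    |∑ c, a c * (B c).indicator (fun _ => (1 : ℝ)) t| ^ p =
      ∑ c, |a c| ^ p * (B c).indicator (fun _ => (1 : ℝ)) t := by
  by_cases h : ∃ c, t ∈ B c
  · obtain ⟨c, hc⟩ := h
    have h0 : ∀ d, d ≠ c → (B d).indicator (fun _ => (1 : ℝ)) t = 0 := fun d hd =>
      indicator_of_notMem (fun hd' => (disjoint_left.1 (hB hd) hd') hc) _
    rw [Finset.sum_eq_single c (fun d _ hd => by rw [h0 d hd, mul_zero]) (by simp),
      Finset.sum_eq_single c (fun d _ hd => by rw [h0 d hd, mul_zero]) (by simp),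
      indicator_of_mem hc, mul_one, mul_one]
  · push Not at h
    have h0 : ∀ c, (B c).indicator (fun _ => (1 : ℝ)) t = 0 := fun c =>
      indicator_of_notMem (h c) _
    simp [h0, Real.zero_rpow hp]

variable {S T : Type*} [MeasurableSpace S] [MeasurableSpace T] {μ : Measure S} {ν : Measure T}
  {p : ℝ} [hp : Fact (1 < p)] [IsFiniteMeasure μ] [IsFiniteMeasure ν]

/-- At each point at most one indicator is nonzero, so the `p`-th power passes through the sum:
disjoint indicators span a weighted `ℓ_p`. -/
theorem norm_sum_indicator_rpow {n : ℕ} {B : Fin n → Set T} (hm : ∀ c, MeasurableSet (B c))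
    (hB : Pairwise (Function.onFun Disjoint B)) (a : Fin n → ℝ) :
    ‖∑ c, a c • indicatorConstLp (ENNReal.ofReal p) (hm c) (measure_ne_top ν _) (1 : ℝ)‖ ^ p =
      ∑ c, |a c| ^ p * ν.real (B c) := by
  have hp0 : 0 < p := zero_lt_one.trans hp.out
  have h : ∀ᵐ t ∂ν, ∀ c, indicatorConstLp (ENNReal.ofReal p) (hm c) (measure_ne_top ν _) (1 : ℝ) t
      = (B c).indicator (fun _ => (1 : ℝ)) t :=
    ae_all_iff.2 fun c => indicatorConstLp_coeFn
  have h' : ⇑(∑ c, a c • indicatorConstLp (ENNReal.ofReal p) (hm c) (measure_ne_top ν _) (1 : ℝ))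
      =ᵐ[ν] fun t => ∑ c, a c * (B c).indicator (fun _ => (1 : ℝ)) t := by
    filter_upwards [h, Lp_coeFn_sum_smul a fun c =>
      indicatorConstLp (ENNReal.ofReal p) (hm c) (measure_ne_top ν _) (1 : ℝ)] with t h1 h2
    rw [h2]
    exact Finset.sum_congr rfl fun c _ => by rw [h1]
  have hi : ∀ c, Integrable ((B c).indicator fun _ => (1 : ℝ)) ν := fun c =>
    (integrable_const _).indicator (hm c)
  rw [Lp_norm_rpow_congr h']
  simp_rw [abs_sum_indicator_rpow hp0.ne' hB a]
  rw [integral_finsetSum _ fun c _ => (hi c).const_mul _]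
  refine Finset.sum_congr rfl fun c _ => ?_
  rw [integral_const_mul, integral_indicator (hm c)]
  simp

/-- For tensors `∑ f_c ⊗ 1_{B_c}` with disjoint `B_c`, the `p`-nuclear norm is at most the
`L_p`-norm. -/
theorem pNuclearNorm_le_of_disjoint {n : ℕ} {B : Fin n → Set T} (hm : ∀ c, MeasurableSet (B c))
    (hB : Pairwise (Function.onFun Disjoint B)) (f : Fin n → Lp ℝ (ENNReal.ofReal p) μ) :
    pNuclearNorm p (∑ c, f c ⊗ₜ[ℝ]
        indicatorConstLp (ENNReal.ofReal p) (hm c) (measure_ne_top ν _) (1 : ℝ)) ≤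
      ‖prodMap p μ ν (∑ c, f c ⊗ₜ[ℝ]
        indicatorConstLp (ENNReal.ofReal p) (hm c) (measure_ne_top ν _) (1 : ℝ))‖ := by
  have hp0 : 0 < p := zero_lt_one.trans hp.out
  set e : Fin n → Lp ℝ (ENNReal.ofReal p) ν :=
    fun c => indicatorConstLp (ENNReal.ofReal p) (hm c) (measure_ne_top ν _) (1 : ℝ) with he
  set b : Fin n → ℝ := fun c => ν.real (B c) with hb
  have hb0 : ∀ c, 0 ≤ b c := fun c => measureReal_nonneg
  have hnorm : ∀ c, ‖e c‖ ^ p = b c := fun c => by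
    rw [he, norm_indicatorConstLp (ofReal_ne_zero_of_fact p) ENNReal.ofReal_ne_top,
      toReal_ofReal_of_fact, norm_one, one_mul, ← Real.rpow_mul (hb0 c),
      one_div_mul_cancel hp0.ne', Real.rpow_one]
  -- Normalising the indicators in `L_p` moves their norms to the first factors. Over a null set
  -- both terms vanish because `e c = 0`.
  have hrep : ∑ c, f c ⊗ₜ[ℝ] e c = ∑ c, (b c ^ (1 / p) • f c) ⊗ₜ[ℝ] ((b c ^ (1 / p))⁻¹ • e c) := by
    refine Finset.sum_congr rfl fun c _ => ?_
    rcases (hb0 c).eq_or_lt with h | h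
    · have : e c = 0 := by
        rw [← norm_eq_zero]
        have := hnorm c
        rw [← h] at this
        exact ((Real.rpow_eq_zero (norm_nonneg _) hp0.ne').1 this)
      rw [this, smul_zero, TensorProduct.tmul_zero, TensorProduct.tmul_zero]
    · rw [TensorProduct.smul_tmul_smul, mul_inv_cancel₀ (Real.rpow_pos_of_pos h _).ne', one_smul]
  have hweak : weakNorm p.conjExponent (fun c => (b c ^ (1 / p))⁻¹ • e c) ≤ 1 := by
    refine weakNorm_le_one hp.out fun a ha => ?_
    simp_rw [smul_smul]
    rw [← Real.rpow_le_rpow_iff (norm_nonneg _) zero_le_one hp0, norm_sum_indicator_rpow hm hB,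
      Real.one_rpow]
    refine (Finset.sum_le_sum fun c _ => ?_).trans ha
    rw [abs_mul, Real.mul_rpow (abs_nonneg _) (abs_nonneg _), mul_assoc]
    -- The factor is one if `b c > 0` and zero if `b c = 0`, as `0⁻¹ = 0`; hence only an inequality.
    refine mul_le_of_le_one_right (by positivity) ?_
    rw [abs_inv, Real.inv_rpow (abs_nonneg _), abs_of_nonneg (Real.rpow_nonneg (hb0 c) _),
      ← Real.rpow_mul (hb0 c), one_div_mul_cancel hp0.ne', Real.rpow_one]
    exact inv_mul_le_one
  have hstrong : ∑ c, ‖b c ^ (1 / p) • f c‖ ^ p =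
      ‖prodMap p μ ν (∑ c, f c ⊗ₜ[ℝ] e c)‖ ^ p := by
    rw [norm_prodMap_rpow]
    simp_rw [he, norm_sum_indicator_rpow hm hB]
    rw [integral_finsetSum _ fun c _ => (MemLp_integrable_rpow (Lp.memLp (f c))).mul_const _]
    refine Finset.sum_congr rfl fun c _ => ?_
    rw [integral_mul_const, ← Lp_norm_rpow, norm_smul, Real.mul_rpow (norm_nonneg _) (norm_nonneg _),
      Real.norm_of_nonneg (Real.rpow_nonneg (hb0 c) _),
      ← Real.rpow_mul (hb0 c), one_div_mul_cancel hp0.ne', Real.rpow_one, mul_comm]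
  rw [show (∑ c, f c ⊗ₜ[ℝ] indicatorConstLp (ENNReal.ofReal p) (hm c) (measure_ne_top ν _)
    (1 : ℝ)) = ∑ c, f c ⊗ₜ[ℝ] e c from rfl]
  refine (pNuclearNorm_le hp.out hrep).trans ?_
  rw [hstrong, ← Real.rpow_mul (norm_nonneg _), mul_one_div_cancel hp0.ne', Real.rpow_one]
  exact mul_le_of_le_one_right (norm_nonneg _) hweak

/-- Finitely many simple functions are linear combinations of indicator functions of the same
disjoint sets. -/
theorem exists_common_partition {n : ℕ} (φ : Fin n → SimpleFunc T ℝ) :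
    ∃ (m : ℕ) (B : Fin m → Set T) (c : Fin m → Fin n → ℝ), (∀ k, MeasurableSet (B k)) ∧
      Pairwise (Function.onFun Disjoint B) ∧
      ∀ i t, φ i t = ∑ k, c k i * (B k).indicator (fun _ => (1 : ℝ)) t := by
  classical
  -- The vector of all the functions takes finitely many values; its fibres are the common
  -- partition.
  let G : T → Fin n → ℝ := fun t i => φ i t
  have hG : (range G).Finite :=
    (Set.Finite.pi' fun i => (φ i).finite_range).subset (by
      rintro _ ⟨t, rfl⟩ i
      exact ⟨t, rfl⟩)
  have hGm : Measurable G := measurable_pi_lambda _ fun i => (φ i).measurable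
  have := hG.fintype
  let e := Fintype.equivFin (range G)
  refine ⟨_, fun k => G ⁻¹' {(e.symm k).1}, fun k => (e.symm k).1,
    fun k => hGm (measurableSet_singleton _), fun k l hkl => ?_, fun i t => ?_⟩
  · refine disjoint_left.2 fun t h1 h2 => hkl (e.symm.injective (Subtype.ext ?_))
    exact (show G t = _ from h1).symm.trans h2
  · rw [Finset.sum_eq_single (e ⟨G t, t, rfl⟩)]
    · simp [G]
    · intro k _ hk
      rw [indicator_of_notMem, mul_zero]
      intro h
      refine hk ?_
      rw [← Equiv.symm_apply_eq]
      exact Subtype.ext (show G t = _ from h).symm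
    · simp

/-- On a common partition every `g i` is a combination of the same disjoint indicators; moving the
coefficients to the first factors reduces to `pNuclearNorm_le_of_disjoint`. -/
theorem pNuclearNorm_le_of_simple {n : ℕ} (f : Fin n → Lp ℝ (ENNReal.ofReal p) μ)
    {g : Fin n → Lp ℝ (ENNReal.ofReal p) ν} {φ : Fin n → SimpleFunc T ℝ}
    (hg : ∀ i, g i =ᵐ[ν] φ i) :
    pNuclearNorm p (∑ i, f i ⊗ₜ[ℝ] g i) ≤ ‖prodMap p μ ν (∑ i, f i ⊗ₜ[ℝ] g i)‖ := by
  obtain ⟨m, B, c, hm, hB, hφ⟩ := exists_common_partition φ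
  have e : ∑ i, f i ⊗ₜ[ℝ] g i = ∑ k, (∑ i, c k i • f i) ⊗ₜ[ℝ]
      indicatorConstLp (ENNReal.ofReal p) (hm k) (measure_ne_top ν _) (1 : ℝ) := by
    have hgi : ∀ i, g i = ∑ k, c k i •
        indicatorConstLp (ENNReal.ofReal p) (hm k) (measure_ne_top ν _) (1 : ℝ) := fun i => by
      ext1
      have h : ∀ᵐ t ∂ν, ∀ k, indicatorConstLp (ENNReal.ofReal p) (hm k) (measure_ne_top ν _)
          (1 : ℝ) t = (B k).indicator (fun _ => (1 : ℝ)) t :=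
        ae_all_iff.2 fun k => indicatorConstLp_coeFn
      filter_upwards [hg i, h, Lp_coeFn_sum_smul (fun k => c k i) fun k =>
        indicatorConstLp (ENNReal.ofReal p) (hm k) (measure_ne_top ν _) (1 : ℝ)] with t h1 h2 h3
      rw [h1, h3, hφ]
      exact Finset.sum_congr rfl fun k _ => by rw [h2]
    simp_rw [fun i => hgi i, TensorProduct.tmul_sum, TensorProduct.sum_tmul,
      TensorProduct.tmul_smul, ← TensorProduct.smul_tmul']
    exact Finset.sum_comm
  rw [e]
  exact pNuclearNorm_le_of_disjoint hm hB _

/-- The `p`-nuclear norm on `L_p(μ) ⊗ L_p(ν)` is dominated by the `L_p`-norm on the product. -/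
theorem pNuclearNorm_le_norm_prodMap
    (h : Lp ℝ (ENNReal.ofReal p) μ ⊗[ℝ] Lp ℝ (ENNReal.ofReal p) ν) :
    pNuclearNorm p h ≤ ‖prodMap p μ ν h‖ := by
  obtain ⟨_, n, f, g, rfl, -⟩ := pNuclear_nonempty p h
  set K := ∑ i, ‖f i‖ with hK
  have hK0 : 0 ≤ K := Finset.sum_nonneg fun i _ => norm_nonneg _
  refine le_of_forall_pos_le_add fun ε hε => ?_
  -- Chosen so that replacing each `g i` within `δ` costs at most `K * δ ≤ ε / 2` in `δ_p`; `K + 1`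
  -- avoids division by zero.
  set δ := ε / (2 * (K + 1)) with hδ
  have hδ0 : 0 < δ := by positivity
  have hg : ∀ i, ∃ (g' : Lp ℝ (ENNReal.ofReal p) ν) (φ : SimpleFunc T ℝ),
      g' =ᵐ[ν] φ ∧ ‖g i - g'‖ ≤ δ := fun i => by
    obtain ⟨φ, h1, h2⟩ := (Lp.memLp (g i)).exists_simpleFunc_eLpNorm_sub_lt ENNReal.ofReal_ne_top
      (ε := ENNReal.ofReal δ) (by simpa using hδ0)
    refine ⟨h2.toLp _, φ, h2.coeFn_toLp, ?_⟩
    have e : g i - h2.toLp _ = ((Lp.memLp (g i)).sub h2).toLp _ := by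
      rw [MemLp.toLp_sub (Lp.memLp (g i)) h2, Lp.toLp_coeFn]
    rw [e, Lp.norm_toLp]
    exact ENNReal.toReal_le_of_le_ofReal hδ0.le h1.le
  choose g' φ hφ hgδ using hg
  have hsplit : ∑ i, f i ⊗ₜ[ℝ] g i = ∑ i, f i ⊗ₜ[ℝ] g' i + ∑ i, f i ⊗ₜ[ℝ] (g i - g' i) := by
    rw [← Finset.sum_add_distrib]
    exact Finset.sum_congr rfl fun i _ => by rw [← TensorProduct.tmul_add, add_sub_cancel]
  have hsmall : pNuclearNorm p (∑ i, f i ⊗ₜ[ℝ] (g i - g' i)) ≤ ε / 2 := by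
    calc _ ≤ ∑ i, pNuclearNorm p (f i ⊗ₜ[ℝ] (g i - g' i)) := pNuclearNorm_sum_le hp.out _ _
      _ ≤ ∑ i, ‖f i‖ * δ := Finset.sum_le_sum fun i _ =>
        (pNuclearNorm_tmul_le hp.out _ _).trans (by gcongr; exact hgδ i)
      _ = K * δ := by rw [← Finset.sum_mul]
      _ ≤ (K + 1) * δ := by gcongr; linarith
      _ = ε / 2 := by rw [hδ]; field_simp
  -- The product norm changes by at most `ε / 2` too, since it is dominated by `δ_p`.
  have h1 : ‖prodMap p μ ν (∑ i, f i ⊗ₜ[ℝ] g' i)‖ ≤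
      ‖prodMap p μ ν (∑ i, f i ⊗ₜ[ℝ] g i)‖ + ε / 2 := by
    rw [hsplit, map_add]
    have := norm_le_norm_add_norm_sub' (prodMap p μ ν (∑ i, f i ⊗ₜ[ℝ] g' i))
      (prodMap p μ ν (∑ i, f i ⊗ₜ[ℝ] g' i) + prodMap p μ ν (∑ i, f i ⊗ₜ[ℝ] (g i - g' i)))
    rw [sub_add_cancel_left, norm_neg] at this
    exact this.trans (by gcongr; exact (norm_prodMap_le _).trans hsmall)
  calc _ ≤ pNuclearNorm p (∑ i, f i ⊗ₜ[ℝ] g' i) +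
        pNuclearNorm p (∑ i, f i ⊗ₜ[ℝ] (g i - g' i)) := by
        rw [hsplit]; exact pNuclearNorm_add_le hp.out _ _
    _ ≤ (‖prodMap p μ ν (∑ i, f i ⊗ₜ[ℝ] g i)‖ + ε / 2) + ε / 2 := by
        gcongr
        exact (pNuclearNorm_le_of_simple f hφ).trans h1
    _ = _ := by ring

/-- `L_p(μ) ⊗ L_p(ν)` is dense in `L_p(μ × ν)`. -/
theorem topologicalClosure_range_prodMap :
    (LinearMap.range (prodMap p μ ν)).topologicalClosure = ⊤ := by
  set V := (LinearMap.range (prodMap p μ ν)).topologicalClosure with hV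
  let J : (A : Set (S × T)) → MeasurableSet A → Lp ℝ (ENNReal.ofReal p) (μ.prod ν) :=
    fun A hA => indicatorConstLp (ENNReal.ofReal p) hA (measure_ne_top _ _) (1 : ℝ)
  have hrect : ∀ (A : Set S) (B : Set T) (hA : MeasurableSet A) (hB : MeasurableSet B),
      J (A ×ˢ B) (hA.prod hB) ∈ V := fun A B hA hB => by
    refine Submodule.le_topologicalClosure _ ⟨
      indicatorConstLp (ENNReal.ofReal p) hA (measure_ne_top _ _) (1 : ℝ) ⊗ₜ
      indicatorConstLp (ENNReal.ofReal p) hB (measure_ne_top _ _) (1 : ℝ), ?_⟩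
    rw [prodMap_tmul]
    ext1
    filter_upwards [prodMul_congr (μ := μ) (ν := ν) (p := p)
      (indicatorConstLp_coeFn (hs := hA) (hμs := measure_ne_top μ _) (c := (1 : ℝ)))
      (indicatorConstLp_coeFn (hs := hB) (hμs := measure_ne_top ν _) (c := (1 : ℝ))),
      indicatorConstLp_coeFn (p := ENNReal.ofReal p) (hs := hA.prod hB)
        (hμs := measure_ne_top (μ.prod ν) _) (c := (1 : ℝ))] with z h1 h2
    rw [h1, h2]
    by_cases hz1 : z.1 ∈ A <;> by_cases hz2 : z.2 ∈ B <;> simp [indicator, hz1, hz2]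
  have hadd : ∀ (A B : Set (S × T)) (hA : MeasurableSet A) (hB : MeasurableSet B),
      Disjoint A B → J (A ∪ B) (hA.union hB) = J A hA + J B hB := fun A B hA hB hd =>
    indicatorConstLp_disjoint_union hA hB _ _ hd _
  have hmem : ∀ (A : Set (S × T)) (hA : MeasurableSet A), J A hA ∈ V := by
    intro A hA
    induction A, hA using MeasurableSpace.induction_on_inter generateFrom_prod.symm
      isPiSystem_prod with
    | empty =>
      have : J ∅ MeasurableSet.empty = 0 := indicatorConstLp_empty
      rw [this]
      exact V.zero_mem
    | basic A hA =>
      obtain ⟨B, hB, C, hC, rfl⟩ := hA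
      exact hrect B C hB hC
    | compl A hA ih =>
      have h1 := hadd A Aᶜ hA hA.compl disjoint_compl_right
      -- The whole space is itself a rectangle, so complements are differences in `V`.
      have h2 : J (A ∪ Aᶜ) (hA.union hA.compl) ∈ V := by
        have := hrect univ univ MeasurableSet.univ MeasurableSet.univ
        convert this using 2
        simp
      rw [← sub_eq_iff_eq_add'] at h1
      rw [← h1]
      exact V.sub_mem h2 ih
    | iUnion A hd hm ih =>
      -- Indicators of the finite partial unions converge in `L_p`: the measure of the remainder
      -- decreases to zero and `p < ∞`.
      have hP : ∀ n, MeasurableSet (⋃ i < n, A i) := fun n =>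
        MeasurableSet.biUnion (to_countable _) fun i _ => hm i
      have hn : ∀ n, J (⋃ i < n, A i) (hP n) ∈ V := by
        intro n
        induction n with
        | zero =>
          have : J (⋃ i < 0, A i) (hP 0) = J ∅ MeasurableSet.empty := by
            congr 1
            simp
          rw [this, show J ∅ MeasurableSet.empty = 0 from indicatorConstLp_empty]
          exact V.zero_mem
        | succ n ihn =>
          have : J (⋃ i < n + 1, A i) (hP (n + 1)) =
              J ((⋃ i < n, A i) ∪ A n) ((hP n).union (hm n)) := by
            congr 1
            exact biUnion_lt_succ A n
          rw [this, hadd _ _ (hP n) (hm n) (by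
            simp only [disjoint_iUnion_left]
            exact fun i hi => hd hi.ne)]
          exact V.add_mem ihn (ih n)
      refine (Submodule.isClosed_topologicalClosure _).mem_of_tendsto
        (f := fun n => J (⋃ i < n, A i) (hP n)) (b := Filter.atTop)
        (tendsto_indicatorConstLp_set ENNReal.ofReal_ne_top ?_) (Filter.Eventually.of_forall hn)
      have hsub : ∀ n, (⋃ i < n, A i) ⊆ ⋃ i, A i := fun n =>
        iUnion₂_subset fun i _ => subset_iUnion A i
      have hmono : Antitone fun n => (⋃ i, A i) \ ⋃ i < n, A i := fun m n hmn =>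
        sdiff_subset_sdiff_right (biUnion_subset_biUnion_left fun i hi => lt_of_lt_of_le hi hmn)
      have hlim := tendsto_measure_iInter_atTop (μ := μ.prod ν)
        (fun n => ((MeasurableSet.iUnion hm).diff (hP n)).nullMeasurableSet) hmono
        ⟨0, measure_ne_top _ _⟩
      have hempty : ⋂ n, ((⋃ i, A i) \ ⋃ i < n, A i) = ∅ := by
        refine eq_empty_of_forall_notMem fun z hz => ?_
        obtain ⟨i, hi⟩ := mem_iUnion.1 (mem_iInter.1 hz 0).1
        exact (mem_iInter.1 hz (i + 1)).2 (mem_iUnion₂.2 ⟨i, i.lt_succ_self, hi⟩)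
      rw [hempty, measure_empty] at hlim
      refine hlim.congr fun n => ?_
      rw [symmDiff_def, sdiff_eq_bot_iff.2 (hsub n), bot_sup_eq]
      rfl
  rw [eq_top_iff]
  rintro F -
  refine Lp.induction ENNReal.ofReal_ne_top (motive := fun F => F ∈ V) (fun c s hs hμs => ?_)
    (fun f g hf hg _ h1 h2 => V.add_mem h1 h2) (Submodule.isClosed_topologicalClosure _) F
  have := V.smul_mem c (hmem _ hs)
  convert this
  rw [Lp.simpleFunc.coe_indicatorConst]
  ext1
  filter_upwards [indicatorConstLp_coeFn (p := ENNReal.ofReal p) (hs := hs)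
      (hμs := hμs.ne) (c := c), indicatorConstLp_coeFn (p := ENNReal.ofReal p) (hs := hs)
      (hμs := hμs.ne) (c := (1 : ℝ)), Lp.coeFn_smul c (J _ hs)] with z h1 h2 h3
  rw [h1, h3, Pi.smul_apply, h2]
  simp [indicator]

end Simple

/-! ### Splitting a set of coordinates into its first and last parts -/

section Split
variable {N m : ℕ}

/-- The coordinates of `v` among the first `N` ones. -/
def leftPart (v : Finset (Fin (N + m))) : Finset (Fin N) :=
  Finset.univ.filter fun i => Fin.castAdd m i ∈ v

/-- The coordinates of `v` among the last `m` ones. -/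
def rightPart (v : Finset (Fin (N + m))) : Finset (Fin m) :=
  Finset.univ.filter fun j => Fin.natAdd N j ∈ v

theorem mem_leftPart {v : Finset (Fin (N + m))} {i : Fin N} :
    i ∈ leftPart v ↔ Fin.castAdd m i ∈ v := by simp [leftPart]

theorem mem_rightPart {v : Finset (Fin (N + m))} {j : Fin m} :
    j ∈ rightPart v ↔ Fin.natAdd N j ∈ v := by simp [rightPart]

/-- Matches the index set of the densities in `N + m` variables with the pairs of index sets
occurring in a tensor product. -/
theorem bijective_parts :
    Function.Bijective fun v : Finset (Fin (N + m)) => (leftPart v, rightPart v) := by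
  classical
  refine ⟨fun v v' h => ?_, fun ⟨u, w⟩ => ⟨Finset.univ.filter fun k =>
    Fin.addCases (fun i => i ∈ u) (fun j => j ∈ w) k, ?_⟩⟩
  · obtain ⟨h1, h2⟩ := Prod.mk.inj h
    ext k
    induction k using Fin.addCases with
    | left i => rw [← mem_leftPart, h1, mem_leftPart]
    | right j => rw [← mem_rightPart, h2, mem_rightPart]
  · refine Prod.ext ?_ ?_
    · ext i
      simp [mem_leftPart]
    · ext j
      simp [mem_rightPart]

/-- A set of coordinates is the disjoint union of its two parts. -/
noncomputable def splitEquiv (v : Finset (Fin (N + m))) : leftPart v ⊕ rightPart v ≃ v :=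
  Equiv.ofBijective
    (Sum.elim (fun i => ⟨Fin.castAdd m i, mem_leftPart.1 i.2⟩)
      (fun j => ⟨Fin.natAdd N j, mem_rightPart.1 j.2⟩)) <| by
    constructor
    · rintro (i | i) (j | j) h
      · have := congrArg Subtype.val h
        simp only [Sum.elim_inl, Fin.castAdd_inj] at this
        rw [Subtype.ext this]
      -- Coordinates of the first part lie below `N`, those of the second do not.
      · have := congrArg (fun k : v => (k : ℕ)) h
        simp at this
        omega
      · have := congrArg (fun k : v => (k : ℕ)) h
        simp at this
        omega
      · have := congrArg Subtype.val h
        simp only [Sum.elim_inr, Fin.natAdd_inj] at this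
        rw [Subtype.ext this]
    · rintro ⟨k, hk⟩
      induction k using Fin.addCases with
      | left i => exact ⟨Sum.inl ⟨i, mem_leftPart.2 hk⟩, rfl⟩
      | right j => exact ⟨Sum.inr ⟨j, mem_rightPart.2 hk⟩, rfl⟩

theorem card_parts (v : Finset (Fin (N + m))) :
    v.card = (leftPart v).card + (rightPart v).card := by
  have := Fintype.card_congr (splitEquiv v)
  simpa using this.symm

/-- The identification `[0,1]^v ≃ [0,1]^{v₁} × [0,1]^{v₂}`, where `v₁` and `v₂` are the two parts
of `v`. -/
noncomputable def splitCube (v : Finset (Fin (N + m))) :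
    (v → I) ≃ᵐ (leftPart v → I) × (rightPart v → I) :=
  (MeasurableEquiv.piCongrLeft (fun _ => I) (splitEquiv v)).symm.trans
    (MeasurableEquiv.sumPiEquivProdPi fun _ => I)

theorem measurePreserving_splitCube (v : Finset (Fin (N + m))) :
    MeasurePreserving (splitCube v) volume (volume.prod volume) :=
  ((volume_measurePreserving_piCongrLeft (fun _ => I) (splitEquiv v)).symm _).trans
    (volume_measurePreserving_sumPiEquivProdPi fun _ => I)

theorem prod_kernel_splitCube (α : ℝ) (v : Finset (Fin (N + m))) (x : Fin (N + m) → I)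
    (t : v → I) :
    ∏ k : v, kernel α (x k) (t k) =
      (∏ i : leftPart v, kernel α (x (Fin.castAdd m i)) ((splitCube v t).1 i)) *
        ∏ j : rightPart v, kernel α (x (Fin.natAdd N j)) ((splitCube v t).2 j) := by
  rw [← Equiv.prod_comp (splitEquiv v), Fintype.prod_sum_type]
  rfl

end Split

/-! ### Spaces of fractional smoothness as finite direct sums of `L_p`-spaces -/

section FracSpace
variable (s : ℕ) (α p : ℝ) [hp : Fact (1 < p)] [hα : Fact (1 / p < α)] [hα1 : Fact (α ≤ 1)]
  (q : ℝ≥0∞) [hq : Fact (1 ≤ q)]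

/-- All norms on the space of fractional smoothness are equivalent to the maximum norm of the
densities. -/
noncomputable def densitiesL : FracSpace s α p q ≃L[ℝ] Densities s p where
  toLinearEquiv := densities s α p q
  continuous_toFun := by
    have hΓ := Real.Gamma_pos_of_pos (alpha_pos α p)
    have hw : Continuous (weighted s α p q) :=
      (AddMonoidHomClass.isometry_of_norm (weighted s α p q) fun f => rfl).continuous
    refine continuous_pi fun u => ?_
    -- Each density is a coordinate of the isometric embedding `weighted` divided by its nonzero
    -- weight.
    have h1 : Continuous fun f => ((Real.Gamma α)⁻¹ ^ u.card)⁻¹ • (weighted s α p q f) u :=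
      (((PiLp.continuous_apply q _ u).comp hw).fun_const_smul _)
    refine h1.congr fun f => ?_
    exact inv_smul_smul₀ (pow_ne_zero _ (inv_ne_zero hΓ.ne')) _
  continuous_invFun := by
    have hi : Topology.IsInducing (weighted s α p q) :=
      (AddMonoidHomClass.isometry_of_norm (weighted s α p q)
        fun f => rfl).isUniformInducing.isInducing
    refine hi.continuous_iff.2 ?_
    have h2 : Continuous fun F : Densities s p =>
        WithLp.toLp q fun u => (Real.Gamma α)⁻¹ ^ u.card • F u :=
      (PiLp.continuous_toLp q _).comp
        (continuous_pi fun u => (continuous_apply u).fun_const_smul _)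
    refine h2.congr fun F => ?_
    have : densities s α p q ((densities s α p q).symm F) = F := LinearEquiv.apply_symm_apply _ _
    exact (congrArg (fun G : Densities s p =>
      (WithLp.toLp q fun u => (Real.Gamma α)⁻¹ ^ u.card • G u :
        PiLp q fun u : Finset (Fin s) => LpCube p u)) this).symm

theorem densitiesL_symm_apply (F : Densities s p) (x : Fin s → I) :
    ((densitiesL s α p q).symm F) x = Phi s α p F x := rfl

theorem Phi_densitiesL (f : FracSpace s α p q) (x : Fin s → I) :
    Phi s α p (densitiesL s α p q f) x = f x := by
  rw [← densitiesL_symm_apply s α p q, ContinuousLinearEquiv.symm_apply_apply]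

/-- The density of a function at the set `u` of coordinates. -/
noncomputable def densityAt (u : Finset (Fin s)) : FracSpace s α p q →L[ℝ] LpCube p u :=
  (ContinuousLinearMap.proj u).comp (densitiesL s α p q).toContinuousLinearMap

/-- The function with the given density at `u` and no others. -/
noncomputable def ofDensityAt (u : Finset (Fin s)) : LpCube p u →L[ℝ] FracSpace s α p q :=
  (densitiesL s α p q).symm.toContinuousLinearMap.comp
    (ContinuousLinearMap.single ℝ (fun u : Finset (Fin s) => LpCube p u) u)

/-- Biorthogonality of projections and injections of the direct sum, written for linear maps so that
it can be substituted into `TensorProduct.map`. -/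
theorem densityAt_ofDensityAt_self (u : Finset (Fin s)) :
    (densityAt s α p q u).toLinearMap ∘ₗ (ofDensityAt s α p q u).toLinearMap = LinearMap.id := by
  ext1 F
  simp [densityAt, ofDensityAt]

theorem densityAt_ofDensityAt_of_ne {u u' : Finset (Fin s)} (h : u' ≠ u) :
    (densityAt s α p q u').toLinearMap ∘ₗ (ofDensityAt s α p q u).toLinearMap = 0 := by
  ext1 F
  simp [densityAt, ofDensityAt, h]

theorem sum_ofDensityAt_densityAt (f : FracSpace s α p q) :
    ∑ u, ofDensityAt s α p q u (densityAt s α p q u f) = f := by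
  apply (densitiesL s α p q).injective
  rw [map_sum]
  simp only [densityAt, ofDensityAt, ContinuousLinearMap.comp_apply,
    ContinuousLinearEquiv.coe_coe, ContinuousLinearEquiv.apply_symm_apply,
    ContinuousLinearMap.proj_apply, ContinuousLinearMap.single_apply]
  exact Finset.univ_sum_single (densitiesL s α p q f)

end FracSpace

/-! ### Tensors of functions and their densities in the joint variables -/

section TensorDensities
variable {N m : ℕ} (α p : ℝ) [hp : Fact (1 < p)] [hα : Fact (1 / p < α)] [hα1 : Fact (α ≤ 1)]
  (q₁ q₂ : ℝ≥0∞) [Fact (1 ≤ q₁)] [Fact (1 ≤ q₂)]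

/-- Functions on `[0,1]^{v₁} × [0,1]^{v₂}` as functions on `[0,1]^v`. -/
noncomputable def joinLp (p : ℝ) [Fact (1 < p)] (v : Finset (Fin (N + m))) :
    Lp ℝ (ENNReal.ofReal p)
      ((volume : Measure (leftPart v → I)).prod (volume : Measure (rightPart v → I))) →ₗᵢ[ℝ]
      LpCube p v :=
  Lp.compMeasurePreservingₗᵢ ℝ (splitCube v) (measurePreserving_splitCube v)

theorem coeFn_joinLp (v : Finset (Fin (N + m))) (F : Lp ℝ (ENNReal.ofReal p)
      ((volume : Measure (leftPart v → I)).prod (volume : Measure (rightPart v → I)))) :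
    joinLp p v F =ᵐ[volume] F ∘ splitCube v :=
  Lp.coeFn_compMeasurePreserving F (measurePreserving_splitCube v)

theorem joinLp_surjective (v : Finset (Fin (N + m))) : Function.Surjective (joinLp p v) := by
  intro k
  have hs := measurePreserving_splitCube v
  refine ⟨Lp.compMeasurePreserving (splitCube v).symm (hs.symm _) k, ?_⟩
  ext1
  filter_upwards [coeFn_joinLp p v (Lp.compMeasurePreserving (splitCube v).symm (hs.symm _) k),
    hs.quasiMeasurePreserving.ae (Lp.coeFn_compMeasurePreserving k (hs.symm _))] with t h1 h2
  rw [h1, Function.comp_apply, h2, Function.comp_apply, MeasurableEquiv.symm_apply_apply]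

/-- The tensor of densities of a tensor of functions, at the two parts of `v`. -/
noncomputable def tensorDensityAt (v : Finset (Fin (N + m))) :
    FracSpace N α p q₁ ⊗[ℝ] FracSpace m α p q₂ →ₗ[ℝ]
      LpCube p (leftPart v) ⊗[ℝ] LpCube p (rightPart v) :=
  TensorProduct.map (densityAt N α p q₁ (leftPart v)).toLinearMap
    (densityAt m α p q₂ (rightPart v)).toLinearMap

/-- The tensor of functions with a given tensor of densities at the two parts of `v`. -/
noncomputable def ofTensorDensityAt (v : Finset (Fin (N + m))) :
    LpCube p (leftPart v) ⊗[ℝ] LpCube p (rightPart v) →ₗ[ℝ]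
      FracSpace N α p q₁ ⊗[ℝ] FracSpace m α p q₂ :=
  TensorProduct.map (ofDensityAt N α p q₁ (leftPart v)).toLinearMap
    (ofDensityAt m α p q₂ (rightPart v)).toLinearMap

/-- The densities of the function on `[0,1]^(N+m)` given by a tensor of functions on `[0,1]^N`
and `[0,1]^m`. -/
noncomputable def toDensities :
    FracSpace N α p q₁ ⊗[ℝ] FracSpace m α p q₂ →ₗ[ℝ] Densities (N + m) p :=
  LinearMap.pi fun v => (joinLp p v).toLinearMap ∘ₗ prodMap p volume volume ∘ₗ
    tensorDensityAt α p q₁ q₂ v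

theorem toDensities_apply (h : FracSpace N α p q₁ ⊗[ℝ] FracSpace m α p q₂)
    (v : Finset (Fin (N + m))) :
    toDensities α p q₁ q₂ h v =
      joinLp p v (prodMap p volume volume (tensorDensityAt α p q₁ q₂ v h)) := rfl

theorem toDensities_tmul (f : FracSpace N α p q₁) (g : FracSpace m α p q₂)
    (v : Finset (Fin (N + m))) :
    toDensities α p q₁ q₂ (f ⊗ₜ g) v =ᵐ[volume] fun t =>
      densitiesL N α p q₁ f (leftPart v) (splitCube v t).1 *
        densitiesL m α p q₂ g (rightPart v) (splitCube v t).2 := by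
  rw [toDensities_apply]
  have e : tensorDensityAt α p q₁ q₂ v (f ⊗ₜ g) =
    densitiesL N α p q₁ f (leftPart v) ⊗ₜ densitiesL m α p q₂ g (rightPart v) := rfl
  rw [e, prodMap_tmul]
  filter_upwards [coeFn_joinLp p v (prodMul (densitiesL N α p q₁ f (leftPart v))
      (densitiesL m α p q₂ g (rightPart v))),
    (measurePreserving_splitCube v).quasiMeasurePreserving.ae
      (coeFn_prodMul (densitiesL N α p q₁ f (leftPart v))
        (densitiesL m α p q₂ g (rightPart v)))] with t h1 h2
  rw [h1, Function.comp_apply, h2]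

/-- The mixed fractional integral operators are multiplicative. -/
theorem Phi_toDensities_tmul (f : FracSpace N α p q₁) (g : FracSpace m α p q₂)
    (x : Fin (N + m) → I) :
    Phi (N + m) α p (toDensities α p q₁ q₂ (f ⊗ₜ g)) x =
      f (fun i => x (Fin.castAdd m i)) * g (fun j => x (Fin.natAdd N j)) := by
  set A : Finset (Fin N) → ℝ := fun u => (Real.Gamma α)⁻¹ ^ u.card *
    ∫ t : u → I, densitiesL N α p q₁ f u t *
      ∏ i : u, kernel α (x (Fin.castAdd m i)) (t i) with hA
  set B : Finset (Fin m) → ℝ := fun w => (Real.Gamma α)⁻¹ ^ w.card *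
    ∫ t : w → I, densitiesL m α p q₂ g w t *
      ∏ j : w, kernel α (x (Fin.natAdd N j)) (t j) with hB
  have hf : f (fun i => x (Fin.castAdd m i)) = ∑ u, A u := (Phi_densitiesL N α p q₁ f _).symm
  have hg : g (fun j => x (Fin.natAdd N j)) = ∑ w, B w := (Phi_densitiesL m α p q₂ g _).symm
  have hterm : ∀ v : Finset (Fin (N + m)), (Real.Gamma α)⁻¹ ^ v.card *
      ∫ t : v → I, toDensities α p q₁ q₂ (f ⊗ₜ g) v t * ∏ k : v, kernel α (x k) (t k) =
      A (leftPart v) * B (rightPart v) := fun v => by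
    let F : (leftPart v → I) → ℝ := fun y => densitiesL N α p q₁ f (leftPart v) y *
      ∏ i : leftPart v, kernel α (x (Fin.castAdd m i)) (y i)
    let G : (rightPart v → I) → ℝ := fun y => densitiesL m α p q₂ g (rightPart v) y *
      ∏ j : rightPart v, kernel α (x (Fin.natAdd N j)) (y j)
    have e : ∫ t : v → I, toDensities α p q₁ q₂ (f ⊗ₜ g) v t * ∏ k : v, kernel α (x k) (t k) =
        (∫ y, F y) * ∫ y, G y := by
      -- Change of variables to the product of the two cubes, then Fubini for a product of functions
      -- in separate variables.
      refine Eq.trans ?_ (((measurePreserving_splitCube v).integral_comp'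
        fun z => F z.1 * G z.2).trans (integral_prod_mul F G))
      refine integral_congr_ae ?_
      filter_upwards [toDensities_tmul α p q₁ q₂ f g v] with t ht
      rw [ht, prod_kernel_splitCube]
      simp only [F, G]
      ring
    rw [e, card_parts, pow_add]
    simp only [hA, hB, F, G]
    ring
  rw [hf, hg, Finset.sum_mul_sum, ← Finset.sum_product',
    show Phi (N + m) α p (toDensities α p q₁ q₂ (f ⊗ₜ g)) x = ∑ v : Finset (Fin (N + m)),
      (Real.Gamma α)⁻¹ ^ v.card * ∫ t : v → I, toDensities α p q₁ q₂ (f ⊗ₜ g) v t *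
        ∏ k : v, kernel α (x k) (t k) from rfl]
  simp_rw [hterm]
  exact Fintype.sum_bijective _ bijective_parts _ _ fun v => rfl

/-- Taking the densities at `v` is bounded for `δ_p`, and on `L_p ⊗ L_p` the product norm is at most
`δ_p`. -/
theorem norm_toDensities_le : ∃ C, ∀ h : FracSpace N α p q₁ ⊗[ℝ] FracSpace m α p q₂,
    ‖toDensities α p q₁ q₂ h‖ ≤ C * pNuclearNorm p h := by
  set c : Finset (Fin (N + m)) → ℝ := fun v =>
    ‖densityAt N α p q₁ (leftPart v)‖ * ‖densityAt m α p q₂ (rightPart v)‖ with hc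
  have hc0 : ∀ v, 0 ≤ c v := fun v => by positivity
  refine ⟨∑ v, c v, fun h => ?_⟩
  have h0 := pNuclearNorm_nonneg hp.out h
  refine (pi_norm_le_iff_of_nonneg (mul_nonneg (Finset.sum_nonneg fun v _ => hc0 v) h0)).2
    fun v => ?_
  rw [toDensities_apply, LinearIsometry.norm_map]
  refine (norm_prodMap_le _).trans ((pNuclearNorm_map_le hp.out _ _ h).trans ?_)
  gcongr
  exact Finset.single_le_sum (fun v _ => hc0 v) (Finset.mem_univ v)

/-- Each factor is the sum of its components; expanding the tensor gives one block for each pair of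
index sets, hence for each `v`. -/
theorem sum_ofTensorDensityAt (h : FracSpace N α p q₁ ⊗[ℝ] FracSpace m α p q₂) :
    ∑ v : Finset (Fin (N + m)),
      ofTensorDensityAt α p q₁ q₂ v (tensorDensityAt α p q₁ q₂ v h) = h := by
  induction h with
  | zero => simp
  | add h k h1 h2 => simp only [map_add, Finset.sum_add_distrib, h1, h2]
  | tmul f g =>
    have h1 := sum_ofDensityAt_densityAt N α p q₁ f
    have h2 := sum_ofDensityAt_densityAt m α p q₂ g
    conv_rhs => rw [← h1, ← h2]
    rw [TensorProduct.sum_tmul]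
    simp_rw [TensorProduct.tmul_sum]
    rw [← Finset.sum_product']
    exact Fintype.sum_bijective _ bijective_parts _ _ fun v => rfl

/-- The triangle inequality over the blocks of `h` suffices: in each block `δ_p` is at most the
`L_p`-norm of the density at `v`. -/
theorem pNuclearNorm_le_toDensities : ∃ C, ∀ h : FracSpace N α p q₁ ⊗[ℝ] FracSpace m α p q₂,
    pNuclearNorm p h ≤ C * ‖toDensities α p q₁ q₂ h‖ := by
  refine ⟨∑ v : Finset (Fin (N + m)),
    ‖ofDensityAt N α p q₁ (leftPart v)‖ * ‖ofDensityAt m α p q₂ (rightPart v)‖, fun h => ?_⟩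
  conv_lhs => rw [← sum_ofTensorDensityAt α p q₁ q₂ h]
  refine (pNuclearNorm_sum_le hp.out _ _).trans ?_
  rw [Finset.sum_mul]
  refine Finset.sum_le_sum fun v _ => (pNuclearNorm_map_le hp.out _ _ _).trans ?_
  gcongr
  refine (pNuclearNorm_le_norm_prodMap _).trans ?_
  rw [← (joinLp p v).norm_map, ← toDensities_apply]
  exact norm_le_pi_norm _ v

theorem toDensities_ofTensorDensityAt (v : Finset (Fin (N + m)))
    (τ : LpCube p (leftPart v) ⊗[ℝ] LpCube p (rightPart v)) :
    toDensities α p q₁ q₂ (ofTensorDensityAt α p q₁ q₂ v τ) =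
      Pi.single v (joinLp p v (prodMap p volume volume τ)) := by
  funext v'
  have hcomp : tensorDensityAt α p q₁ q₂ v' (ofTensorDensityAt α p q₁ q₂ v τ) =
      TensorProduct.map
        ((densityAt N α p q₁ (leftPart v')).toLinearMap ∘ₗ
          (ofDensityAt N α p q₁ (leftPart v)).toLinearMap)
        ((densityAt m α p q₂ (rightPart v')).toLinearMap ∘ₗ
          (ofDensityAt m α p q₂ (rightPart v)).toLinearMap) τ := by
    rw [TensorProduct.map_comp]
    rfl
  rw [toDensities_apply, hcomp]
  rcases eq_or_ne v' v with rfl | hne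
  · rw [densityAt_ofDensityAt_self, densityAt_ofDensityAt_self, TensorProduct.map_id,
      LinearMap.id_apply, Pi.single_eq_same]
  · rw [Pi.single_eq_of_ne hne]
    -- Distinct sets differ in one part, and there the corresponding tensor factor is zero.
    have hparts : leftPart v' ≠ leftPart v ∨ rightPart v' ≠ rightPart v := by
      by_contra! hcon
      exact hne (bijective_parts.1 (Prod.ext hcon.1 hcon.2))
    rcases hparts with hl | hr
    · rw [densityAt_ofDensityAt_of_ne _ _ _ _ hl, TensorProduct.map_zero_left,
        LinearMap.zero_apply, map_zero, map_zero]
    · rw [densityAt_ofDensityAt_of_ne _ _ _ _ hr, TensorProduct.map_zero_right,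
        LinearMap.zero_apply, map_zero, map_zero]

/-- The range contains, for each `v`, the image of `L_p ⊗ L_p` in the single coordinate `v`, which
is dense there; finitely many coordinates are then summed. -/
theorem denseRange_toDensities :
    DenseRange (toDensities (N := N) (m := m) α p q₁ q₂) := by
  set V := (LinearMap.range (toDensities (N := N) (m := m) α p q₁ q₂)).topologicalClosure with hV
  have hsingle : ∀ (v : Finset (Fin (N + m))) (k : LpCube p v),
      (Pi.single v k : Densities (N + m) p) ∈ V := fun v k => by
    obtain ⟨k, rfl⟩ := joinLp_surjective p v k
    have hk : k ∈ (LinearMap.range (prodMap p (volume : Measure (leftPart v → I))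
        (volume : Measure (rightPart v → I)))).topologicalClosure := by
      rw [topologicalClosure_range_prodMap]
      trivial
    have hcont : Continuous fun k => (Pi.single v (joinLp p v k) : Densities (N + m) p) :=
      (continuous_single v).comp (joinLp p v).continuous
    refine closure_minimal (t := (fun k => (Pi.single v (joinLp p v k) :
      Densities (N + m) p)) ⁻¹' V) ?_
      ((Submodule.isClosed_topologicalClosure _).preimage hcont) hk
    rintro _ ⟨τ, rfl⟩
    exact Submodule.le_topologicalClosure _
      ⟨ofTensorDensityAt α p q₁ q₂ v τ, toDensities_ofTensorDensityAt α p q₁ q₂ v τ⟩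
  intro F
  have hF : F ∈ V := by
    rw [← Finset.univ_sum_single F]
    exact V.sum_mem fun v _ => hsingle v (F v)
  exact hF

/-- The `p`-nuclear tensor product of two spaces of fractional smoothness is isomorphic to the
space of fractional smoothness in the joint variables. -/
theorem exists_nuclearTensor_equiv (q : ℝ≥0∞) [Fact (1 ≤ q)] :
    ∃ T : NuclearTensor p (FracSpace N α p q₁) (FracSpace m α p q₂) ≃L[ℝ]
        FracSpace (N + m) α p q,
      ∀ (f : FracSpace N α p q₁) (g : FracSpace m α p q₂) (x : Fin (N + m) → I),
        T (NuclearTensor.tmul p f g) x =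
          f (fun i => x (Fin.castAdd m i)) * g (fun j => x (Fin.natAdd N j)) := by
  let E := AlgTensor p (FracSpace N α p q₁) (FracSpace m α p q₂)
  let e₁ : E →ₗ[ℝ] UniformSpace.Completion E :=
    (UniformSpace.Completion.toComplL (𝕜 := ℝ) (E := E)).toLinearMap
  let e₂ : E →ₗ[ℝ] Densities (N + m) p := toDensities α p q₁ q₂
  have d₁ : DenseRange e₁ := UniformSpace.Completion.denseRange_coe
  have d₂ : DenseRange e₂ := denseRange_toDensities α p q₁ q₂
  have hn : ∀ h : E, ‖e₁ h‖ = pNuclearNorm p (X := FracSpace N α p q₁)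
    (Y := FracSpace m α p q₂) h := fun h => UniformSpace.Completion.norm_coe h
  -- Through `e₁` and `e₂` the space `E` maps densely into two Banach spaces with equivalent induced
  -- seminorms, so its identity extends to an isomorphism between them.
  have b₁ : ∃ C, ∀ h, ‖e₂ (LinearEquiv.refl ℝ E h)‖ ≤ C * ‖e₁ h‖ := by
    obtain ⟨C, hC⟩ := norm_toDensities_le (N := N) (m := m) α p q₁ q₂
    exact ⟨C, fun h => by rw [hn]; exact hC h⟩
  have b₂ : ∃ C, ∀ h, ‖e₁ ((LinearEquiv.refl ℝ E).symm h)‖ ≤ C * ‖e₂ h‖ := by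
    obtain ⟨C, hC⟩ := pNuclearNorm_le_toDensities (N := N) (m := m) α p q₁ q₂
    exact ⟨C, fun h => by rw [hn]; exact hC h⟩
  refine ⟨((LinearEquiv.refl ℝ E).extend e₁ e₂ d₁ b₁ d₂ b₂).trans
    (densitiesL (N + m) α p q).symm, fun f g x => ?_⟩
  rw [ContinuousLinearEquiv.trans_apply, densitiesL_symm_apply,
    ← Phi_toDensities_tmul α p q₁ q₂ f g x]
  have := LinearEquiv.extend_eq (LinearEquiv.refl ℝ E) e₁ e₂ d₁ b₁ d₂ b₂
    (show E from f ⊗ₜ[ℝ] g)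
  exact congrArg (fun F => Phi (N + m) α p F x) this

end TensorDensities

end FracSmooth

/-- `H_{α,s-1,p} ⊗_{δ_p} H_{α,p} = H_{α,s,p}` with equivalent norms, where `f ⊗ g` is identified
with the function `x ↦ f(x_1, …, x_{s-1}) g(x_s)`, the univariate space is `H_{α,1,p}`, and each
of the three spaces may carry any of its norms, with parameters `q₁`, `q₂`, `q`. -/
theorem theorem3p4 (p α : ℝ) [Fact (1 < p)] [Fact (1 / p < α)] [Fact (α ≤ 1)]
    (s : ℕ) (hs : 2 ≤ s) (q₁ q₂ q : ℝ≥0∞) [Fact (1 ≤ q₁)] [Fact (1 ≤ q₂)] [Fact (1 ≤ q)] :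
    ∃ T : FracSmooth.NuclearTensor p (FracSmooth.FracSpace (s - 1) α p q₁)
        (FracSmooth.FracSpace 1 α p q₂) ≃L[ℝ] FracSmooth.FracSpace s α p q,
      ∀ (f : FracSmooth.FracSpace (s - 1) α p q₁) (g : FracSmooth.FracSpace 1 α p q₂)
        (x : Fin s → unitInterval),
        T (FracSmooth.NuclearTensor.tmul p f g) x =
          f (fun i => x (Fin.castLE (Nat.sub_le s 1) i)) *
            g (fun _ => x ⟨s - 1, by omega⟩) := by
  -- This removes the truncated subtraction: `N + 1 - 1` reduces to `N` by definition, so `T` has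
  -- the required type.
  obtain ⟨N, rfl⟩ : ∃ N, s = N + 1 := ⟨s - 1, by omega⟩
  obtain ⟨T, hT⟩ := FracSmooth.exists_nuclearTensor_equiv (N := N) (m := 1) α p q₁ q₂ q
  refine ⟨T, fun f g x => (hT f g x).trans ?_⟩
  have e : (fun j : Fin 1 => x (Fin.natAdd N j)) = fun _ => x ⟨N + 1 - 1, by omega⟩ := by
    funext j
    congr 1
    ext
    simp
  rw [e]
  rfl
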